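/- Let $n\ge k\ge 1$ be integers and let $q\in\mathbb C$ satisfy $q\neq 0$, $q\neq -1$ and $q^p\neq 1$ for $p=2,\dots,n$. Let $H_n(q)$ be the quotient of the complex group algebra of the braid group $\mathbb B_n$ (with standard generators $g_1,\dots,g_{n-1}$) by the relations $g_i^2=(q-1)g_i+q$, and put $e_i=\frac{1+g_i}{q+1}$. Let $\iota\colon H_k(q)\to H_n(q)$, $g_i\mapsto g_i$, and $\sigma\colon H_m(q)\to H_{m+1}(q)$, $g_i\mapsto g_{i+1}$, denote the canonical homomorphisms. Define $A_m,A_{-m}\in H_m(q)$ by $A_1=A_{-1}=1$, $$A_{m+1}=\sum_{j=0}^{m} g_jg_{j-1}\cdots g_1\,\sigma(A_m),\qquad A_{-m-1}=\sum_{j=0}^{m}(-q^{-1})^j g_jg_{j-1}\cdots g_1\,\sigma(A_{-m}),$$ and, with $m!_q=\prod_{r=1}^m(1+q+\dots+q^{r-1})$, let $E_k=\iota(A_k)/k!_q$ and $E_{-k}=\iota(A_{-k})/k!_{1/q}$ in $H_n(q)$. For a Young diagram $\mu$ with $n$ squares let $V_\mu$ be the complex vector space with a basis $(v_t)$ indexed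 by the standard tableaux $t$ of shape $\mu$. There are representations $\pi_\mu\colon H_n(q)\to \mathrm{End}(V_\mu)$ given by $$\pi_\mu(e_i)v_t=a_d\,(v_t+v_{s_it}),\qquad a_d=\frac{1-q^{d+1}}{(1+q)(1-q^d)},$$ where $d=c_t(i)-c_t(i+1)$, $c_t(j)$ is the content (column index minus row index) of the square of $t$ containing $j$, $s_it$ is $t$ with $i$ and $i+1$ exchanged, and $v_{s_it}=0$ if $s_it$ is not standard. (So $\pi_{[1^n]}(e_i)=1$ and $\pi_{[n]}(e_i)=0$.) The map $(\pi_\mu)_\mu\colon H_n(q)\to\prod_\mu\mathrm{End}(V_\mu)$ is an isomorphism; thus $H_n(q)$ is semisimple and the $\pi_\mu$ are its irreducible representations, each occurring once up to equivalence. Let $p_\mu$ be the minimal central idempotent corresponding to $\pi_\mu$, that is, the central idempotent with $\ker\pi_\mu=(1-p_\mu)H_n(q)$. Then: 1. the two-sided ideal of $H_n(q)$ generated by $E_k$ is the two-sided ideal generated by the $p_\mu$ for which $\mu$ has at least $k$ rows; 2. the two-sided ideal of $H_n(q)$ generated by $E_{-k}$ is the two-sided ideal generated by the $p_\mu$ for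 which $\mu$ has at least $k$ columns. -/

import Mathlib

noncomputable section

namespace Hecke

/-! ### Braid groups and Hecke algebras

The standard generators `g_1, …, g_{n-1}` are indexed by `Fin (n - 1)`:
the element `i : Fin (n - 1)` stands for the generator `g_{i+1}`. -/

/-- The braid relations: `g_i g_j = g_j g_i` for `|i - j| > 1` and
`g_i g_{i+1} g_i = g_{i+1} g_i g_{i+1}`. -/
def braidRels (n : ℕ) : Set (FreeGroup (Fin (n - 1))) :=
  {r | ∃ i j : Fin (n - 1), (i : ℕ) + 1 < j ∧
      r = FreeGroup.of i * FreeGroup.of j * (FreeGroup.of j * FreeGroup.of i)⁻¹} ∪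
  {r | ∃ i j : Fin (n - 1), (i : ℕ) + 1 = j ∧
      r = FreeGroup.of i * FreeGroup.of j * FreeGroup.of i *
        (FreeGroup.of j * FreeGroup.of i * FreeGroup.of j)⁻¹}

/-- The braid group on `n` strands. -/
abbrev BraidGroup (n : ℕ) : Type := PresentedGroup (braidRels n)

/-- The image of a standard generator of the braid group in its complex group algebra. -/
def braidGen (n : ℕ) (i : Fin (n - 1)) : MonoidAlgebra ℂ (BraidGroup n) :=
  MonoidAlgebra.of ℂ (BraidGroup n) (PresentedGroup.of i)

/-- The quadratic relations `g_i ^ 2 = (q - 1) g_i + q`. -/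
inductive QuadRel (n : ℕ) (q : ℂ) :
    MonoidAlgebra ℂ (BraidGroup n) → MonoidAlgebra ℂ (BraidGroup n) → Prop
  | quad (i : Fin (n - 1)) :
      QuadRel n q (braidGen n i ^ 2) ((q - 1) • braidGen n i + q • 1)

/-- The Hecke algebra `H_n(q)`: the quotient of the complex group algebra of the braid group
on `n` strands by the quadratic relations. -/
def HeckeAlgebra (n : ℕ) (q : ℂ) : Type := RingQuot (QuadRel n q)

instance (n : ℕ) (q : ℂ) : Ring (HeckeAlgebra n q) :=
  inferInstanceAs (Ring (RingQuot (QuadRel n q)))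

instance (n : ℕ) (q : ℂ) : Algebra ℂ (HeckeAlgebra n q) :=
  inferInstanceAs (Algebra ℂ (RingQuot (QuadRel n q)))

/-- The quotient map `ℂ[B_n] → H_n(q)`. -/
def mk (n : ℕ) (q : ℂ) : MonoidAlgebra ℂ (BraidGroup n) →ₐ[ℂ] HeckeAlgebra n q :=
  RingQuot.mkAlgHom ℂ (QuadRel n q)

/-- The generators `g_i` of `H_n(q)`. -/
def gen (n : ℕ) (q : ℂ) (i : Fin (n - 1)) : HeckeAlgebra n q :=
  mk n q (braidGen n i)

/-- The idempotents `e_i = (1 + g_i) / (q + 1)` of `H_n(q)`. -/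
def idem (n : ℕ) (q : ℂ) (i : Fin (n - 1)) : HeckeAlgebra n q :=
  (q + 1)⁻¹ • (1 + gen n q i)

/-- The index map `i ↦ i + c`. -/
def shiftIdx {n m c : ℕ} (h : n + c ≤ m) (i : Fin (n - 1)) : Fin (m - 1) :=
  ⟨i + c, by omega⟩

theorem braid_shift_rel {n m c : ℕ} (h : n + c ≤ m) :
    ∀ r ∈ braidRels n, FreeGroup.lift
      (fun i => (PresentedGroup.of (shiftIdx h i) : BraidGroup m)) r = 1 := by
  rintro r (⟨i, j, hij, rfl⟩ | ⟨i, j, hij, rfl⟩)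
  · have := PresentedGroup.one_of_mem (rels := braidRels m)
      (Or.inl ⟨shiftIdx h i, shiftIdx h j, by simp only [shiftIdx]; omega, rfl⟩)
    simp only [map_mul, map_inv, FreeGroup.lift_apply_of] at this ⊢
    exact this
  · have := PresentedGroup.one_of_mem (rels := braidRels m)
      (Or.inr ⟨shiftIdx h i, shiftIdx h j, by simp only [shiftIdx]; omega, rfl⟩)
    simp only [map_mul, map_inv, FreeGroup.lift_apply_of] at this ⊢
    exact this

/-- The homomorphism of braid groups `g_i ↦ g_{i+c}`. -/
def braidShift {n m c : ℕ} (h : n + c ≤ m) : BraidGroup n →* BraidGroup m :=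
  PresentedGroup.toGroup (braid_shift_rel h)

/-- The homomorphism `ℂ[B_n] → H_m(q)`, `g_i ↦ g_{i+c}`. -/
def preShift {n m c : ℕ} (q : ℂ) (h : n + c ≤ m) :
    MonoidAlgebra ℂ (BraidGroup n) →ₐ[ℂ] HeckeAlgebra m q :=
  (mk m q).comp
    (MonoidAlgebra.lift ℂ _ (BraidGroup n)
      ((MonoidAlgebra.of ℂ (BraidGroup m)).comp (braidShift h)))

theorem preShift_braidGen {n m c : ℕ} (q : ℂ) (h : n + c ≤ m) (i : Fin (n - 1)) :
    preShift q h (braidGen n i) = gen m q (shiftIdx h i) := by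
  simp only [preShift, braidGen, gen, AlgHom.comp_apply, MonoidAlgebra.lift_of,
    MonoidHom.comp_apply, braidShift, PresentedGroup.toGroup.of]

theorem gen_sq (n : ℕ) (q : ℂ) (i : Fin (n - 1)) :
    gen n q i ^ 2 = (q - 1) • gen n q i + q • 1 := by
  have : mk n q (braidGen n i ^ 2) = mk n q ((q - 1) • braidGen n i + q • 1) :=
    RingQuot.mkAlgHom_rel ℂ (QuadRel.quad i)
  simp only [map_pow, map_add, map_smul, map_one] at this
  exact this

theorem preShift_rel {n m c : ℕ} (q : ℂ) (h : n + c ≤ m) ⦃x y : MonoidAlgebra ℂ (BraidGroup n)⦄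
    (hxy : QuadRel n q x y) : preShift q h x = preShift q h y := by
  obtain ⟨i⟩ := hxy
  simp only [map_pow, map_add, map_smul, map_one, preShift_braidGen, gen_sq]

/-- The algebra homomorphism `H_n(q) → H_m(q)`, `g_i ↦ g_{i+c}`, for `n + c ≤ m`. -/
def shift {n m c : ℕ} (q : ℂ) (h : n + c ≤ m) : HeckeAlgebra n q →ₐ[ℂ] HeckeAlgebra m q :=
  RingQuot.liftAlgHom ℂ ⟨preShift q h, preShift_rel q h⟩

theorem shift_gen {n m c : ℕ} (q : ℂ) (h : n + c ≤ m) (i : Fin (n - 1)) :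
    shift q h (gen n q i) = gen m q (shiftIdx h i) := by
  exact (RingQuot.liftAlgHom_mkAlgHom_apply ℂ _ (preShift_rel q h) _).trans
    (preShift_braidGen q h i)

/-- The canonical map `ι : H_k(q) → H_n(q)`, `g_i ↦ g_i`, for `k ≤ n`. -/
abbrev incl {k n : ℕ} (q : ℂ) (h : k ≤ n) : HeckeAlgebra k q →ₐ[ℂ] HeckeAlgebra n q :=
  shift (c := 0) q h

/-- The map `σ : H_n(q) → H_{n+1}(q)`, `g_i ↦ g_{i+1}`. -/
abbrev sigma (n : ℕ) (q : ℂ) : HeckeAlgebra n q →ₐ[ℂ] HeckeAlgebra (n + 1) q :=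
  shift (c := 1) q le_rfl

/-! ### Symmetrizers and antisymmetrizers -/

/-- The descending word `g_j g_{j-1} ⋯ g_1` in `H_{n+1}(q)`, for `0 ≤ j ≤ n`. -/
def descWord (n : ℕ) (q : ℂ) (j : Fin (n + 1)) : HeckeAlgebra (n + 1) q :=
  (List.ofFn fun m : Fin j => gen (n + 1) q ⟨m, by omega⟩).reverse.prod

/-- The elements `A_k ∈ H_k(q)`: `A_1 = 1` and
`A_{k+1} = σ(A_k) + g_1 σ(A_k) + ⋯ + g_k ⋯ g_1 σ(A_k)`.
(The recursion is started at the conventional value `A_0 = 1`, which gives `A_1 = 1`.) -/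
def posA (q : ℂ) : (k : ℕ) → HeckeAlgebra k q
  | 0 => 1
  | k + 1 => ∑ j : Fin (k + 1), descWord k q j * sigma k q (posA q k)

/-- The elements `A_{-k} ∈ H_k(q)`: `A_{-1} = 1` and
`A_{-k-1} = σ(A_{-k}) - q⁻¹ g_1 σ(A_{-k}) + ⋯ + (-q⁻¹)^k g_k ⋯ g_1 σ(A_{-k})`. -/
def negA (q : ℂ) : (k : ℕ) → HeckeAlgebra k q
  | 0 => 1
  | k + 1 => ∑ j : Fin (k + 1),
      (-q⁻¹) ^ (j : ℕ) • (descWord k q j * sigma k q (negA q k))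

/-- The quantum factorial `n!_q = ∏_{m=1}^n (1 + q + ⋯ + q^{m-1})`. -/
def qFactorial (q : ℂ) (n : ℕ) : ℂ :=
  ∏ m ∈ Finset.range n, ∑ i ∈ Finset.range (m + 1), q ^ i

/-- The idempotent `E_k = A_k / k!_q` of `H_k(q)`, regarded as an element of `H_n(q)`, `k ≤ n`. -/
def E {k n : ℕ} (q : ℂ) (h : k ≤ n) : HeckeAlgebra n q :=
  incl q h ((qFactorial q k)⁻¹ • posA q k)

/-- The idempotent `E_{-k} = A_{-k} / k!_{1/q}` of `H_k(q)`, regarded as an element of `H_n(q)`,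
`k ≤ n`. -/
def Eneg {k n : ℕ} (q : ℂ) (h : k ≤ n) : HeckeAlgebra n q :=
  incl q h ((qFactorial q⁻¹ k)⁻¹ • negA q k)

/-! ### The irreducible representations labelled by Young diagrams -/

/-- Young diagrams with `n` squares (`(r, c)` is the square in row `r` and column `c`). -/
abbrev Diagram (n : ℕ) : Type := {μ : YoungDiagram // μ.card = n}

/-- The number of rows of a Young diagram (the length of its first column). -/
def numRows (μ : YoungDiagram) : ℕ := μ.colLen 0

/-- The number of columns of a Young diagram (the length of its first row). -/
def numCols (μ : YoungDiagram) : ℕ := μ.rowLen 0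

/-- Standard tableaux of shape `μ` with entries `0, …, n - 1`: a bijection `pos` which sends an
entry to its square, such that the entries increase along the rows and down the columns. -/
@[ext]
structure StdTableau (n : ℕ) (μ : YoungDiagram) where
  pos : Fin n ≃ {c : ℕ × ℕ // c ∈ μ.cells}
  standard : ∀ a b : Fin n, (pos a : ℕ × ℕ) ≤ (pos b : ℕ × ℕ) → a ≤ b

/-- The entry `i`, for `i : Fin (n - 1)`. -/
def entry {n : ℕ} (i : Fin (n - 1)) : Fin n := ⟨i, by omega⟩

/-- The entry `i + 1`, for `i : Fin (n - 1)`. -/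
def entrySucc {n : ℕ} (i : Fin (n - 1)) : Fin n := ⟨i + 1, by omega⟩

/-- The content `c - r` of the square `(r, c)` which holds the entry `a`. -/
def StdTableau.content {n : ℕ} {μ : YoungDiagram} (t : StdTableau n μ) (a : Fin n) : ℤ :=
  ((t.pos a : ℕ × ℕ).2 : ℤ) - ((t.pos a : ℕ × ℕ).1 : ℤ)

/-- The axial distance from the entry `i + 1` to the entry `i`. It is `1` if `i + 1` stands
immediately below `i`, and `-1` if `i + 1` stands immediately to the right of `i`. -/
def StdTableau.axialDist {n : ℕ} {μ : YoungDiagram} (t : StdTableau n μ) (i : Fin (n - 1)) : ℤ :=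
  t.content (entry i) - t.content (entrySucc i)

/-- The basis vector of the tableau obtained from `t` by exchanging the entries `i` and `i + 1`
if that tableau is standard, and `0` otherwise. -/
def swapVec {n : ℕ} {μ : YoungDiagram} (i : Fin (n - 1)) (t : StdTableau n μ) :
    StdTableau n μ →₀ ℂ :=
  open Classical in
  if h : ∃ s : StdTableau n μ, s.pos = (Equiv.swap (entry i) (entrySucc i)).trans t.pos then
    Finsupp.single h.choose 1
  else 0

/-- The rational function `a_d(q) = (1 - q^{d+1}) / ((1 + q) (1 - q^d))`. -/
def seminormalCoeff (q : ℂ) (d : ℤ) : ℂ :=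
  (1 - q ^ (d + 1)) / ((1 + q) * (1 - q ^ d))

/-- The action of `e_i` in the (semi-normal form of the) representation labelled by `μ`,
on the vector space with the standard tableaux of shape `μ` as a basis:
`e_i v_t = a_d (v_t + v_{s_i t})`, where `d` is the axial distance of `i` and `i + 1` in `t`,
`s_i t` is `t` with `i` and `i + 1` exchanged, and `v_{s_i t} = 0` if `s_i t` is not standard.

For instance `e_i` acts as `1` on a one-column diagram, as `0` on a one-row diagram, and a
rescaling of the basis vectors turns the operators into the orthogonal form
`e_i v_t = a_d v_t + (a_d a_{-d})^{1/2} v_{s_i t}`. -/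
def youngOp (n : ℕ) (q : ℂ) (μ : YoungDiagram) (i : Fin (n - 1)) :
    Module.End ℂ (StdTableau n μ →₀ ℂ) :=
  Finsupp.linearCombination ℂ fun t =>
    seminormalCoeff q (t.axialDist i) • (Finsupp.single t 1 + swapVec i t)

/-- `π` is the family of the irreducible representations `π_μ` of `H_n(q)` labelled by the Young
diagrams `μ` with `n` squares: `π_μ(e_i)` is the semi-normal form operator, and
the `π_μ` identify `H_n(q)` with the product of the full matrix algebras `End(V_μ)`; that is,
`H_n(q)` is semisimple, the `π_μ` are irreducible and pairwise inequivalent, and they are all the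
irreducible representations up to equivalence. (Since the `e_i` generate `H_n(q)`, the first
condition determines `π`.) -/
structure IsYoungFamily (n : ℕ) (q : ℂ)
    (π : (μ : Diagram n) → HeckeAlgebra n q →ₐ[ℂ] Module.End ℂ (StdTableau n μ.1 →₀ ℂ)) :
    Prop where
  map_idem : ∀ (μ : Diagram n) (i : Fin (n - 1)), π μ (idem n q i) = youngOp n q μ.1 i
  bijective : Function.Bijective
    fun (x : HeckeAlgebra n q) (μ : Diagram n) => π μ x

/-- `p` is the central support of the representation `π`: the (unique) central idempotent such that
the kernel of `π` is the ideal `(1 - p) H`. If `π` is one of the irreducible representations of a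
semisimple algebra, then `p` is the minimal central idempotent corresponding to `π`. -/
structure IsCentralSupport {H B : Type*} [Semiring H] [Algebra ℂ H] [Semiring B] [Algebra ℂ B]
    (π : H →ₐ[ℂ] B) (p : H) : Prop where
  isIdempotentElem : p * p = p
  central : ∀ x : H, p * x = x * p
  ker : ∀ x : H, π x = 0 ↔ p * x = 0

/-- The two-sided ideal `I` corresponds to the set `S` of Young diagrams: `I` is generated by
the minimal central idempotents `p_μ` of the irreducible representations `π_μ` with `μ ∈ S`
(in other words, by the sum of these orthogonal central idempotents). -/
def CorrespondsTo {n : ℕ} {q : ℂ}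
    (π : (μ : Diagram n) → HeckeAlgebra n q →ₐ[ℂ] Module.End ℂ (StdTableau n μ.1 →₀ ℂ))
    (I : TwoSidedIdeal (HeckeAlgebra n q)) (S : Set (Diagram n)) : Prop :=
  ∃ p : Diagram n → HeckeAlgebra n q,
    (∀ μ, IsCentralSupport (π μ) (p μ)) ∧ I = TwoSidedIdeal.span (p '' S)

end Hecke

end

/-! Under the isomorphism of $H_n(q)$ with $\prod_\mu \mathrm{End}(V_\mu)$, an element generates the
sum of those matrix blocks in which its component is nonzero (`Generic.correspondsTo_span`). Both
claims thus amount to deciding when $\pi_\mu(E_{\pm k})\neq 0$.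

Since $g_iA_k=qA_k$ and $g_iA_{-k}=-A_{-k}$ for $i<k$ (`gen_mul_posA`, `gen_mul_negA`), the image of
$A_{\pm k}$ consists of common eigenvectors of $g_1,\dots,g_{k-1}$, and on such vectors $A_{\pm k}$
acts by a nonzero quantum factorial. As $g_i=(1+q)e_i-1$, the question is whether $V_\mu$ contains a
nonzero vector fixed, respectively killed, by $e_1,\dots,e_{k-1}$. The support of a fixed vector is
closed under admissible exchanges of the first $k$ entries and contains no tableau with $i+1$
immediately to the right of $i$, for $i<k$. If $\mu$ has fewer than $k$ rows, the first $k$ entries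
do not fit into the first column, so exchanges bring the second entry to the right of the first,
which is impossible. Conversely, a tableau that starts with $k$ entries down the first column gives
a fixed vector. Killed vectors are the transposed case (`Generic.exists_fixed_iff`,
`Generic.exists_killed_iff`).

The isomorphism is proved as well. The seminormal operators satisfy the Hecke relations by rational
identities among the $a_d$; the powers of $q$ that occur have exponents of absolute value at most
$n$, so the denominators do not vanish. Surjectivity: the Murphy operators lie in the image and are
diagonal with eigenvalues that separate all tableaux, so the diagonal matrix units lie in the image;
compressing $e_i$ between them gives the units joining neighbouring tableaux, and any two tableaux
of one shape are joined by exchanges. Injectivity is a dimension count, $n!\ge\dim H_n(q)\ge\sum_\mu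
f_\mu^2\ge n!$ with $f_\mu=\dim V_\mu$: the first bound comes from normal forms
(`finrank_le_factorial`), the last from Young's lattice (`factorial_le_sum_pathCount_sq`). -/

noncomputable section

namespace Hecke

/-! ### Fillings of Young diagrams -/

/-- Bijective fillings of the diagram `μ` with the entries `0, …, n - 1`. -/
abbrev Filling (n : ℕ) (μ : YoungDiagram) : Type := Fin n ≃ {c : ℕ × ℕ // c ∈ μ.cells}

/-- The filling `f` is a standard tableau. -/
def IsStd {n : ℕ} {μ : YoungDiagram} (f : Filling n μ) : Prop :=
  ∀ a b : Fin n, (f a : ℕ × ℕ) ≤ (f b : ℕ × ℕ) → a ≤ b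

/-- The filling obtained by exchanging the entries `i` and `i + 1`. -/
def swapFill {n : ℕ} {μ : YoungDiagram} (i : Fin (n - 1)) (f : Filling n μ) : Filling n μ :=
  (Equiv.swap (entry i) (entrySucc i)).trans f

/-- The content of a square. -/
def cellContent (c : ℕ × ℕ) : ℤ := (c.2 : ℤ) - (c.1 : ℤ)

/-- The axial distance between the entries `i` and `i + 1` of a filling. -/
def fillDist {n : ℕ} {μ : YoungDiagram} (f : Filling n μ) (i : Fin (n - 1)) : ℤ :=
  cellContent (f (entry i)) - cellContent (f (entrySucc i))

section Fillings

variable {n : ℕ} {μ : YoungDiagram}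

theorem card_of_filling (f : Filling n μ) : μ.card = n := by
  simpa using (Fintype.card_congr f).symm

theorem entry_ne_entrySucc (i : Fin (n - 1)) : entry i ≠ entrySucc i := by
  simp [entry, entrySucc, Fin.ext_iff]

@[simp] theorem val_entry (i : Fin (n - 1)) : ((entry i : Fin n) : ℕ) = i := rfl

@[simp] theorem val_entrySucc (i : Fin (n - 1)) : ((entrySucc i : Fin n) : ℕ) = i + 1 := rfl

@[simp] theorem swapFill_entry (i : Fin (n - 1)) (f : Filling n μ) :
    swapFill i f (entry i) = f (entrySucc i) := by simp [swapFill]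

@[simp] theorem swapFill_entrySucc (i : Fin (n - 1)) (f : Filling n μ) :
    swapFill i f (entrySucc i) = f (entry i) := by simp [swapFill]

theorem swapFill_of_ne (i : Fin (n - 1)) (f : Filling n μ) {a : Fin n} (h1 : (a : ℕ) ≠ i)
    (h2 : (a : ℕ) ≠ i + 1) : swapFill i f a = f a := by
  simp only [swapFill, Equiv.trans_apply]
  rw [Equiv.swap_apply_of_ne_of_ne]
  · intro h; exact h1 (by rw [h]; rfl)
  · intro h; exact h2 (by rw [h]; rfl)

@[simp] theorem swapFill_swapFill (i : Fin (n - 1)) (f : Filling n μ) :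
    swapFill i (swapFill i f) = f := by
  ext1 a; simp [swapFill]

/-- Exchanging consecutive entries reverses the order of that one pair only, so no other comparison
can break standardness. -/
theorem isStd_swapFill_iff {f : Filling n μ} (hf : IsStd f) (i : Fin (n - 1)) :
    IsStd (swapFill i f) ↔ ¬ (f (entry i) : ℕ × ℕ) ≤ f (entrySucc i) := by
  constructor
  · intro h hle
    have := h (entrySucc i) (entry i) (by simpa using hle)
    rw [Fin.le_def] at this
    simp at this
  · intro h a b hab
    by_contra hlt
    have key := hf (Equiv.swap (entry i) (entrySucc i) a) (Equiv.swap (entry i) (entrySucc i) b) hab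
    rw [not_le] at hlt
    have e1 := val_entry i
    have e2 := val_entrySucc i
    rw [Equiv.swap_apply_def, Equiv.swap_apply_def] at key
    by_cases hb : b = entry i
    · by_cases ha : a = entrySucc i
      · subst ha hb
        simp at hab
        exact h hab
      · subst hb
        have ha' : a ≠ entry i := ne_of_gt hlt
        simp only [ha, ha', if_false, if_true, Fin.le_def] at key
        rw [Fin.lt_def] at hlt
        rw [Fin.ext_iff] at ha
        omega
    · split_ifs at key <;> simp only [Fin.le_def, Fin.lt_def, Fin.ext_iff] at * <;> omega

/-- Every bound on differences of contents rests on this count of the cells in a hook; such bounds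
keep the exponents of $q$ within the range covered by the genericity hypothesis. -/
theorem hook_le_card (C : Finset (ℕ × ℕ)) (a b : ℕ) (ha : ∀ j < a, (0, j) ∈ C)
    (hb : ∀ j < b, (j + 1, 0) ∈ C) : a + b ≤ C.card := by
  have h : ((Finset.range a).image fun j => ((0, j) : ℕ × ℕ)) ∪
      ((Finset.range b).image fun j => ((j + 1, 0) : ℕ × ℕ)) ⊆ C := by
    intro x hx
    simp only [Finset.mem_union, Finset.mem_image, Finset.mem_range] at hx
    rcases hx with ⟨j, hj, rfl⟩ | ⟨j, hj, rfl⟩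
    · exact ha j hj
    · exact hb j hj
  refine le_trans (le_of_eq ?_) (Finset.card_le_card h)
  rw [Finset.card_union_of_disjoint, Finset.card_image_of_injective, Finset.card_image_of_injective,
    Finset.card_range, Finset.card_range]
  · intro x y h; simpa using h
  · intro x y h; simpa using h
  · rw [Finset.disjoint_left]
    intro x hx hy
    simp only [Finset.mem_image] at hx hy
    obtain ⟨_, _, rfl⟩ := hx
    obtain ⟨_, _, h⟩ := hy
    simp at h

theorem abs_cellContent_sub_lt {x y : ℕ × ℕ} (hx : x ∈ μ) (hy : y ∈ μ) :
    |cellContent x - cellContent y| < μ.card := by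
  have aux : ∀ x y : ℕ × ℕ, x ∈ μ → y ∈ μ → x.2 + y.1 < μ.card := by
    intro x y hx hy
    change x.2 + y.1 < μ.cells.card
    have := hook_le_card μ.cells (x.2 + 1) y.1
      (fun j hj => μ.up_left_mem (i2 := x.1) (j2 := x.2) (by omega) (by omega) hx)
      (fun j hj => μ.up_left_mem (i2 := y.1) (j2 := y.2) (by omega) (by omega) hy)
    omega
  have h1 := aux x y hx hy
  have h2 := aux y x hy hx
  simp only [cellContent]
  rw [abs_lt]
  constructor <;> omega

theorem IsStd.eq_of_between {f : Filling n μ} (hf : IsStd f) {a b : Fin n}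
    (hab : (a : ℕ) + 1 = b) {x : ℕ × ℕ} (h1 : (f a : ℕ × ℕ) ≤ x) (h2 : x ≤ f b) :
    x = f a ∨ x = f b := by
  have hx : x ∈ μ.cells := μ.isLowerSet h2 (f b).2
  obtain ⟨e, he⟩ := f.surjective ⟨x, hx⟩
  have he' : (f e : ℕ × ℕ) = x := by rw [he]
  have ha := hf a e (he' ▸ h1)
  have hb := hf e b (he' ▸ h2)
  rw [Fin.le_def] at ha hb
  rcases (by omega : (e : ℕ) = a ∨ (e : ℕ) = b) with h | h
  · left; rw [← he', Fin.ext h]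
  · right; rw [← he', Fin.ext h]

theorem IsStd.adjacent {f : Filling n μ} (hf : IsStd f) {a b : Fin n}
    (hab : (a : ℕ) + 1 = b) (h : (f a : ℕ × ℕ) ≤ f b) :
    (f b : ℕ × ℕ) = ((f a : ℕ × ℕ).1 + 1, (f a : ℕ × ℕ).2) ∨
      (f b : ℕ × ℕ) = ((f a : ℕ × ℕ).1, (f a : ℕ × ℕ).2 + 1) := by
  have hne : (f a : ℕ × ℕ) ≠ f b := by
    intro h
    have := f.injective (Subtype.ext h)
    rw [this] at hab; omega
  obtain ⟨h1, h2⟩ := Prod.le_def.mp h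
  rcases Nat.lt_or_ge (f a : ℕ × ℕ).1 (f b : ℕ × ℕ).1 with hr | hr
  · left
    rcases hf.eq_of_between hab (x := ((f a : ℕ × ℕ).1 + 1, (f a : ℕ × ℕ).2))
      (Prod.le_def.mpr ⟨by simp, by simp⟩) (Prod.le_def.mpr ⟨by simpa using hr, h2⟩) with h | h
    · have := congrArg Prod.fst h; simp at this
    · exact h.symm
  · right
    have hc : (f a : ℕ × ℕ).2 < (f b : ℕ × ℕ).2 := by
      by_contra hc
      exact hne (Prod.ext (by omega) (by omega))
    rcases hf.eq_of_between hab (x := ((f a : ℕ × ℕ).1, (f a : ℕ × ℕ).2 + 1))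
      (Prod.le_def.mpr ⟨by simp, by simp⟩) (Prod.le_def.mpr ⟨by simpa using h1, hc⟩) with h | h
    · have := congrArg Prod.snd h; simp at this
    · exact h.symm

/-- The possible axial distances between consecutive entries of a standard tableau. -/
theorem IsStd.fillDist_cases {f : Filling n μ} (hf : IsStd f) (i : Fin (n - 1)) :
    ((f (entry i) : ℕ × ℕ) ≤ f (entrySucc i) ∧ (fillDist f i = 1 ∨ fillDist f i = -1)) ∨
    (¬ (f (entry i) : ℕ × ℕ) ≤ f (entrySucc i) ∧ (2 ≤ fillDist f i ∨ fillDist f i ≤ -2)) := by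
  by_cases h : (f (entry i) : ℕ × ℕ) ≤ f (entrySucc i)
  · left
    refine ⟨h, ?_⟩
    rcases hf.adjacent rfl h with h | h <;> simp only [fillDist, cellContent, h] <;> push_cast
    · left; ring
    · right; ring
  · right
    refine ⟨h, ?_⟩
    have h' : ¬ (f (entrySucc i) : ℕ × ℕ) ≤ f (entry i) := by
      intro h'
      have := hf _ _ h'
      rw [Fin.le_def] at this
      simp at this
    rw [Prod.le_def] at h h'
    simp only [fillDist, cellContent]
    omega

theorem IsStd.fillDist_ne_zero {f : Filling n μ} (hf : IsStd f) (i : Fin (n - 1)) :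
    fillDist f i ≠ 0 := by
  rcases hf.fillDist_cases i with h | h <;> omega

theorem abs_fillDist_lt (f : Filling n μ) (i : Fin (n - 1)) : |fillDist f i| < n := by
  have := abs_cellContent_sub_lt (μ := μ) (f (entry i)).2 (f (entrySucc i)).2
  rwa [card_of_filling f] at this

theorem IsStd.fillDist_eq_of_not {f : Filling n μ} (hf : IsStd f) {i : Fin (n - 1)}
    (h : ¬ IsStd (swapFill i f)) : fillDist f i = 1 ∨ fillDist f i = -1 := by
  rw [isStd_swapFill_iff hf, not_not] at h
  rcases hf.fillDist_cases i with h' | h'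
  · exact h'.2
  · exact absurd h h'.1

theorem IsStd.two_le_abs {f : Filling n μ} (hf : IsStd f) {i : Fin (n - 1)}
    (h : IsStd (swapFill i f)) : 2 ≤ fillDist f i ∨ fillDist f i ≤ -2 := by
  rw [isStd_swapFill_iff hf] at h
  rcases hf.fillDist_cases i with h' | h'
  · exact absurd h'.1 h
  · exact h'.2

/-- Otherwise $i$ and $i+2$ lie on one diagonal, with the second strictly below and to the right of
the first. The cells immediately below and immediately to the right of $i$ would then both have to
hold the only intermediate entry $i+1$. -/
theorem IsStd.fillDist_add_ne_zero {f : Filling n μ} (hf : IsStd f) {i j : Fin (n - 1)}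
    (hij : (i : ℕ) + 1 = j) : fillDist f i + fillDist f j ≠ 0 := by
  have hs : (entry j : Fin n) = entrySucc i := Fin.ext (by simp [hij])
  intro h0
  simp only [fillDist, cellContent, hs] at h0
  have hne : (f (entry i) : ℕ × ℕ) ≠ f (entrySucc j) := by
    intro h
    have := congrArg Fin.val (f.injective (Subtype.ext h))
    simp at this; omega
  have hle : (f (entry i) : ℕ × ℕ).1 < (f (entrySucc j) : ℕ × ℕ).1 ∧
      (f (entry i) : ℕ × ℕ).2 < (f (entrySucc j) : ℕ × ℕ).2 := by
    by_contra hc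
    have hle' : (f (entrySucc j) : ℕ × ℕ) ≤ f (entry i) := by
      rw [Prod.le_def]; constructor <;> omega
    have := hf _ _ hle'
    rw [Fin.le_def] at this
    simp at this
    omega
  have mid : ∀ x : ℕ × ℕ, (f (entry i) : ℕ × ℕ) ≤ x → x ≤ f (entrySucc j) →
      x ≠ f (entry i) → x ≠ f (entrySucc j) → x = f (entrySucc i) := by
    intro x h1 h2 h3 h4
    obtain ⟨e, he⟩ := f.surjective ⟨x, μ.isLowerSet h2 (f (entrySucc j)).2⟩
    have he' : (f e : ℕ × ℕ) = x := by rw [he]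
    have ha := hf _ e (he'.symm ▸ h1)
    have hb := hf e _ (he'.symm ▸ h2)
    have hc : e ≠ entry i := by rintro rfl; exact h3 he'.symm
    have hd : e ≠ entrySucc j := by rintro rfl; exact h4 he'.symm
    rw [← he']
    congr 2
    simp only [Fin.le_def, ne_eq, Fin.ext_iff, val_entry, val_entrySucc] at *
    omega
  have e1 := mid ((f (entry i) : ℕ × ℕ).1 + 1, (f (entry i) : ℕ × ℕ).2)
    (Prod.le_def.mpr (by simp)) (Prod.le_def.mpr ⟨by simpa using hle.1, by simpa using hle.2.le⟩)
    (by intro h; simpa using congrArg Prod.fst h)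
    (by intro h; have := congrArg Prod.snd h; simp at this; omega)
  have e2 := mid ((f (entry i) : ℕ × ℕ).1, (f (entry i) : ℕ × ℕ).2 + 1)
    (Prod.le_def.mpr (by simp)) (Prod.le_def.mpr ⟨by simpa using hle.1.le, by simpa using hle.2⟩)
    (by intro h; simpa using congrArg Prod.snd h)
    (by intro h; have := congrArg Prod.fst h; simp at this; omega)
  have := congrArg Prod.fst (e1.trans e2.symm)
  simp at this

theorem abs_fillDist_add_lt (f : Filling n μ) {i j : Fin (n - 1)}
    (hij : (i : ℕ) + 1 = j) : |fillDist f i + fillDist f j| < n := by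
  have hs : (entry j : Fin n) = entrySucc i := Fin.ext (by simp [hij])
  have := abs_cellContent_sub_lt (μ := μ) (f (entry i)).2 (f (entrySucc j)).2
  rw [card_of_filling f] at this
  simpa [fillDist, hs] using this

theorem fillDist_swapFill_self (f : Filling n μ) (i : Fin (n - 1)) :
    fillDist (swapFill i f) i = - fillDist f i := by
  simp [fillDist]

theorem fillDist_swapFill_far (f : Filling n μ) {i j : Fin (n - 1)}
    (hij : (i : ℕ) + 1 < j ∨ (j : ℕ) + 1 < i) : fillDist (swapFill i f) j = fillDist f j := by
  simp only [fillDist]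
  rw [swapFill_of_ne, swapFill_of_ne] <;> simp <;> omega

theorem fillDist_swapFill_succ (f : Filling n μ) {i j : Fin (n - 1)} (hij : (i : ℕ) + 1 = j) :
    fillDist (swapFill i f) j = fillDist f i + fillDist f j := by
  have hs : (entry j : Fin n) = entrySucc i := Fin.ext (by simp [hij])
  simp only [fillDist, hs, swapFill_entrySucc]
  rw [swapFill_of_ne] <;> simp <;> omega

theorem fillDist_swapFill_pred (f : Filling n μ) {i j : Fin (n - 1)} (hij : (i : ℕ) + 1 = j) :
    fillDist (swapFill j f) i = fillDist f i + fillDist f j := by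
  have hs : (entrySucc i : Fin n) = entry j := Fin.ext (by simp [hij])
  simp only [fillDist, hs, swapFill_entry]
  rw [swapFill_of_ne] <;> simp <;> omega

theorem swap_braid {i j : Fin (n - 1)} (hij : (i : ℕ) + 1 = j) (f : Filling n μ) :
    swapFill i (swapFill j (swapFill i f)) = swapFill j (swapFill i (swapFill j f)) := by
  have hs : (entry j : Fin n) = entrySucc i := Fin.ext (by simp [hij])
  have h1 : (entrySucc j : Fin n) ≠ entry i := by simp [Fin.ext_iff]; omega
  have h2 := entry_ne_entrySucc i
  have h3 := entry_ne_entrySucc j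
  rw [hs] at h3
  have e : Equiv.swap (entry i) (entrySucc i) * Equiv.swap (entrySucc i) (entrySucc j) *
      Equiv.swap (entry i) (entrySucc i) = Equiv.swap (entrySucc i) (entrySucc j) *
      Equiv.swap (entry i) (entrySucc i) * Equiv.swap (entrySucc i) (entrySucc j) := by
    rw [Equiv.swap_mul_swap_mul_swap h2 h1.symm, Equiv.swap_comm (entry i) (entrySucc i),
      Equiv.swap_comm (entrySucc i) (entrySucc j), Equiv.swap_mul_swap_mul_swap h3.symm h1,
      Equiv.swap_comm]
  ext1 a
  simp only [swapFill, Equiv.trans_apply, hs]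
  exact congrArg f (DFunLike.congr_fun e a)

theorem swap_comm_of_far {i j : Fin (n - 1)} (hij : (i : ℕ) + 1 < j) (f : Filling n μ) :
    swapFill i (swapFill j f) = swapFill j (swapFill i f) := by
  ext1 a
  have h1 : (entry j : Fin n) ≠ entry i := by simp [Fin.ext_iff]; omega
  have h2 : (entry j : Fin n) ≠ entrySucc i := by simp [Fin.ext_iff]; omega
  have h3 : (entrySucc j : Fin n) ≠ entry i := by simp [Fin.ext_iff]; omega
  have h4 : (entrySucc j : Fin n) ≠ entrySucc i := by simp [Fin.ext_iff]; omega
  simp only [swapFill, Equiv.trans_apply]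
  congr 1
  simp only [Equiv.swap_apply_def] at *
  split_ifs <;> simp_all

theorem not_le_of_isStd {f : Filling n μ} (hf : IsStd f) {a b : Fin n} (h : b < a) :
    ¬ (f a : ℕ × ℕ) ≤ f b := fun h' => absurd (hf a b h') (not_le.mpr h)

theorem isStd_of_far {i j : Fin (n - 1)} (hij : (i : ℕ) + 1 < j) {f : Filling n μ} (hf : IsStd f)
    (h : IsStd (swapFill i (swapFill j f))) : IsStd (swapFill i f) ∧ IsStd (swapFill j f) := by
  rw [isStd_swapFill_iff hf, isStd_swapFill_iff hf]
  constructor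
  · have := not_le_of_isStd h (a := entrySucc i) (b := entry i) (by rw [Fin.lt_def]; simp)
    rw [swapFill_entry, swapFill_entrySucc, swapFill_of_ne, swapFill_of_ne] at this
    · exact this
    all_goals simp
    all_goals omega
  · rw [swap_comm_of_far hij] at h
    have := not_le_of_isStd h (a := entrySucc j) (b := entry j) (by rw [Fin.lt_def]; simp)
    rw [swapFill_entry, swapFill_entrySucc, swapFill_of_ne, swapFill_of_ne] at this
    · exact this
    all_goals simp
    all_goals omega

/-- The triple exchange reverses $i,i+1,i+2$. If the result is still standard, the three cells are
pairwise incomparable, so every intermediate exchange is admissible. -/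
theorem isStd_of_braid {i j : Fin (n - 1)} (hij : (i : ℕ) + 1 = j) {f : Filling n μ}
    (hf : IsStd f) (h : IsStd (swapFill i (swapFill j (swapFill i f)))) :
    IsStd (swapFill i f) ∧ IsStd (swapFill j (swapFill i f)) ∧
      IsStd (swapFill j f) ∧ IsStd (swapFill i (swapFill j f)) := by
  have hs : (entry j : Fin n) = entrySucc i := Fin.ext (by simp [hij])
  have a1 : swapFill i f (entrySucc j) = f (entrySucc j) := swapFill_of_ne _ _ (by simp; omega)
    (by simp; omega)
  have a2 : swapFill j f (entry i) = f (entry i) := swapFill_of_ne _ _ (by simp; omega)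
    (by simp; omega)
  have a3 : swapFill j (swapFill i f) (entry i) = swapFill i f (entry i) :=
    swapFill_of_ne _ _ (by simp; omega) (by simp; omega)
  have a4 : swapFill i (swapFill j (swapFill i f)) (entrySucc j) =
    swapFill j (swapFill i f) (entrySucc j) := swapFill_of_ne _ _ (by simp; omega) (by simp; omega)
  have f0 : swapFill i (swapFill j (swapFill i f)) (entry i) = f (entrySucc j) := by
    rw [swapFill_entry, ← hs, swapFill_entry, a1]
  have f1 : swapFill i (swapFill j (swapFill i f)) (entrySucc i) = f (entrySucc i) := by
    rw [swapFill_entrySucc, a3, swapFill_entry]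
  have f2 : swapFill i (swapFill j (swapFill i f)) (entrySucc j) = f (entry i) := by
    rw [a4, swapFill_entrySucc, hs, swapFill_entrySucc]
  have n1 : ¬ (f (entry i) : ℕ × ℕ) ≤ f (entrySucc i) := by
    have := not_le_of_isStd h (a := entrySucc j) (b := entrySucc i) (by rw [Fin.lt_def]; simp; omega)
    rwa [f1, f2] at this
  have n2 : ¬ (f (entry i) : ℕ × ℕ) ≤ f (entrySucc j) := by
    have := not_le_of_isStd h (a := entrySucc j) (b := entry i) (by rw [Fin.lt_def]; simp; omega)
    rwa [f0, f2] at this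
  have n3 : ¬ (f (entrySucc i) : ℕ × ℕ) ≤ f (entrySucc j) := by
    have := not_le_of_isStd h (a := entrySucc i) (b := entry i) (by rw [Fin.lt_def]; simp)
    rwa [f0, f1] at this
  have s1 : IsStd (swapFill i f) := (isStd_swapFill_iff hf i).mpr n1
  have s2 : IsStd (swapFill j f) := (isStd_swapFill_iff hf j).mpr (by rwa [hs])
  refine ⟨s1, (isStd_swapFill_iff s1 j).mpr ?_, s2, (isStd_swapFill_iff s2 i).mpr ?_⟩
  · rwa [hs, swapFill_entrySucc, a1]
  · rwa [a2, ← hs, swapFill_entry]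

end Fillings

/-! ### The seminormal coefficients -/

section Coefficients

variable {q : ℂ}

theorem zpow_ne_one_of_abs_le {n : ℕ} (hn : 2 ≤ n) (hq : ∀ p : ℕ, 2 ≤ p → p ≤ n → q ^ p ≠ 1)
    {d : ℤ} (hd : d ≠ 0) (hdn : |d| ≤ n) : q ^ d ≠ 1 := by
  have key : ∀ p : ℕ, p ≠ 0 → p ≤ n → q ^ p ≠ 1 := by
    intro p hp hpn
    -- The exponent 1 is not covered by the hypothesis, but $q=1$ would give $q^2=1$.
    rcases (by omega : p = 1 ∨ 2 ≤ p) with rfl | h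
    · intro h; exact hq 2 le_rfl hn (by rw [pow_one] at h; simp [h])
    · exact hq p h hpn
  obtain ⟨m, rfl | rfl⟩ := Int.eq_nat_or_neg d
  · rw [zpow_natCast]; exact key m (by simpa using hd) (by simpa using hdn)
  · rw [zpow_neg, zpow_natCast]
    intro h
    exact key m (by simpa using hd) (by simpa using hdn) (inv_eq_one.mp h)

/-- This is the trace of $e_i$ on the span of $v_t$ and $v_{s_it}$, where $e_i$ is to be an
idempotent of rank one. -/
theorem seminormalCoeff_add_neg (hq0 : q ≠ 0) (hq1 : 1 + q ≠ 0) {d : ℤ} (hd : q ^ d ≠ 1) :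
    seminormalCoeff q d + seminormalCoeff q (-d) = 1 := by
  have hX : q ^ d ≠ 0 := zpow_ne_zero _ hq0
  have h1 : 1 - q ^ d ≠ 0 := sub_ne_zero.mpr hd.symm
  simp only [seminormalCoeff, zpow_add₀ hq0, zpow_neg, zpow_one]
  generalize q ^ d = X at *
  have h2 : 1 - X⁻¹ ≠ 0 := by
    rw [sub_ne_zero]; intro h; exact hd (by rw [← inv_inv X, ← h, inv_one])
  have h3 : (1 - X⁻¹) = -(1 - X) / X := by field_simp; ring
  rw [h3]
  field_simp
  ring

theorem seminormalCoeff_one (hq1 : 1 + q ≠ 0) (hq : q ≠ 1) : seminormalCoeff q 1 = 1 := by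
  have h1 : 1 - q ≠ 0 := sub_ne_zero.mpr hq.symm
  simp only [seminormalCoeff, zpow_one]
  rw [show (1 : ℤ) + 1 = 2 by norm_num, zpow_ofNat]
  field_simp
  ring

theorem seminormalCoeff_neg_one : seminormalCoeff q (-1) = 0 := by
  simp [seminormalCoeff]

theorem seminormalCoeff_braid (hq0 : q ≠ 0) (hq1 : 1 + q ≠ 0) {u v : ℤ} (hu : q ^ u ≠ 1)
    (hv : q ^ v ≠ 1) (huv : q ^ (u + v) ≠ 1) :
    seminormalCoeff q u * seminormalCoeff q v + seminormalCoeff q (u + v) * seminormalCoeff q (-u) =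
      q / (1 + q) ^ 2 + seminormalCoeff q v * seminormalCoeff q (u + v) := by
  have hU : q ^ u ≠ 0 := zpow_ne_zero _ hq0
  have hV : q ^ v ≠ 0 := zpow_ne_zero _ hq0
  simp only [seminormalCoeff, zpow_add₀ hq0, zpow_neg, zpow_one] at *
  generalize q ^ u = U at *
  generalize q ^ v = V at *
  have h1 : 1 - U ≠ 0 := sub_ne_zero.mpr hu.symm
  have h2 : 1 - V ≠ 0 := sub_ne_zero.mpr hv.symm
  have h4 : 1 - U * V ≠ 0 := sub_ne_zero.mpr huv.symm
  have h3 : (1 - U⁻¹) = -(1 - U) / U := by field_simp; ring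
  rw [h3]
  field_simp
  ring

theorem seminormalCoeff_ne_zero {d : ℤ} (hq1 : 1 + q ≠ 0) (hd : q ^ d ≠ 1)
    (hd1 : q ^ (d + 1) ≠ 1) : seminormalCoeff q d ≠ 0 :=
  div_ne_zero (sub_ne_zero.mpr hd1.symm) (mul_ne_zero hq1 (sub_ne_zero.mpr hd.symm))

end Coefficients

/-! ### The seminormal representations -/

section Seminormal

variable {n : ℕ} {μ : YoungDiagram} {q : ℂ}

open Classical in
/-- The basis vector of a filling, which is `0` unless the filling is standard. -/
def tabVec (f : Filling n μ) : StdTableau n μ →₀ ℂ :=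
  if h : IsStd f then Finsupp.single ⟨f, h⟩ 1 else 0

theorem StdTableau.isStd (t : StdTableau n μ) : IsStd t.pos := t.standard

theorem tabVec_pos (t : StdTableau n μ) : tabVec t.pos = Finsupp.single t 1 :=
  dif_pos t.isStd

theorem tabVec_of_not {f : Filling n μ} (h : ¬ IsStd f) : tabVec f = 0 := dif_neg h

theorem swapVec_eq (i : Fin (n - 1)) (t : StdTableau n μ) :
    swapVec i t = tabVec (swapFill i t.pos) := by
  classical
  by_cases h : IsStd (swapFill i t.pos)
  · have hex : ∃ s : StdTableau n μ, s.pos = (Equiv.swap (entry i) (entrySucc i)).trans t.pos :=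
      ⟨⟨_, h⟩, rfl⟩
    rw [swapVec, dif_pos hex, tabVec, dif_pos h]
    congr 1
    exact StdTableau.ext hex.choose_spec
  · rw [tabVec_of_not h, swapVec, dif_neg]
    rintro ⟨s, hs⟩
    have := s.isStd
    rw [hs] at this
    exact h this

theorem axialDist_eq (t : StdTableau n μ) (i : Fin (n - 1)) : t.axialDist i = fillDist t.pos i :=
  rfl

theorem youngOp_single (i : Fin (n - 1)) (t : StdTableau n μ) :
    youngOp n q μ i (Finsupp.single t 1) =
      seminormalCoeff q (fillDist t.pos i) •
        (Finsupp.single t 1 + tabVec (swapFill i t.pos)) := by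
  rw [youngOp, Finsupp.linearCombination_single, one_smul, swapVec_eq, axialDist_eq]

theorem youngOp_tabVec {f : Filling n μ} (hf : IsStd f) (i : Fin (n - 1)) :
    youngOp n q μ i (tabVec f) =
      seminormalCoeff q (fillDist f i) • (tabVec f + tabVec (swapFill i f)) := by
  have := youngOp_single (q := q) i (⟨f, hf⟩ : StdTableau n μ)
  rwa [← tabVec_pos] at this

open Classical in
/-- The indicator of standardness. -/
def stdInd (f : Filling n μ) : ℂ := if IsStd f then 1 else 0

theorem stdInd_of {f : Filling n μ} (h : IsStd f) : stdInd f = 1 := if_pos h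

theorem stdInd_of_not {f : Filling n μ} (h : ¬ IsStd f) : stdInd f = 0 := if_neg h

/-- A formula valid for all fillings lets words in the $e_i$ be expanded by `simp` without case
distinctions. The indicator is needed because a nonstandard filling has zero vector while its
exchange may be standard. -/
theorem youngOp_tabVec' (f : Filling n μ) (i : Fin (n - 1)) :
    youngOp n q μ i (tabVec f) =
      seminormalCoeff q (fillDist f i) • (tabVec f + stdInd f • tabVec (swapFill i f)) := by
  by_cases hf : IsStd f
  · rw [youngOp_tabVec hf, stdInd_of hf, one_smul]
  · rw [tabVec_of_not hf, stdInd_of_not hf]; simp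

theorem end_ext {S T : Module.End ℂ (StdTableau n μ →₀ ℂ)}
    (h : ∀ f : Filling n μ, IsStd f → S (tabVec f) = T (tabVec f)) : S = T := by
  refine Finsupp.lhom_ext' fun t => LinearMap.ext_ring ?_
  have := h t.pos t.isStd
  rw [tabVec_pos] at this
  simpa using this

/-- The parameter is not a root of unity of order at most `n`, as far as this is
needed for the seminormal form. -/
structure Generic (n : ℕ) (q : ℂ) : Prop where
  ne_zero : q ≠ 0
  ne_neg_one : q ≠ -1
  pow_ne_one : ∀ p : ℕ, 2 ≤ p → p ≤ n → q ^ p ≠ 1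

theorem Generic.one_add_ne (h : Generic n q) : 1 + q ≠ 0 := fun h' =>
  h.ne_neg_one (by linear_combination h')

theorem Generic.zpow_ne (h : Generic n q) (i : Fin (n - 1)) {d : ℤ} (hd : d ≠ 0)
    (hdn : |d| ≤ n) : q ^ d ≠ 1 :=
  zpow_ne_one_of_abs_le (by have := i.2; omega) h.pow_ne_one hd hdn

theorem Generic.ne_one (h : Generic n q) (i : Fin (n - 1)) : q ≠ 1 := by
  have := h.zpow_ne i (d := 1) one_ne_zero (by have := i.2; simp; omega)
  simpa using this

theorem Generic.zpow_fillDist (h : Generic n q) {f : Filling n μ} (hf : IsStd f)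
    (i : Fin (n - 1)) : q ^ fillDist f i ≠ 1 :=
  h.zpow_ne i (hf.fillDist_ne_zero i) (abs_fillDist_lt f i).le

theorem Generic.coeff_ne_zero (h : Generic n q) {f : Filling n μ} (hf : IsStd f) {i : Fin (n - 1)}
    (hs : IsStd (swapFill i f)) : seminormalCoeff q (fillDist f i) ≠ 0 := by
  have hd := hf.two_le_abs hs
  have hdn := abs_fillDist_lt f i
  refine seminormalCoeff_ne_zero h.one_add_ne (h.zpow_fillDist hf i)
    (h.zpow_ne i (by omega) ?_)
  rw [abs_lt] at hdn
  rw [abs_le]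
  constructor <;> omega

/-- An inadmissible exchange forces $d=\pm1$, and then $a_da_{-d}=0$ because $a_{-1}=0$. Terms that
return to $f$ through a nonstandard filling therefore vanish by themselves. -/
theorem coeff_mul_neg {f : Filling n μ} (hf : IsStd f)
    (i : Fin (n - 1)) :
    stdInd (swapFill i f) *
      (seminormalCoeff q (fillDist f i) * seminormalCoeff q (-fillDist f i)) =
    seminormalCoeff q (fillDist f i) * seminormalCoeff q (-fillDist f i) := by
  by_cases hs : IsStd (swapFill i f)
  · rw [stdInd_of hs, one_mul]
  · rcases hf.fillDist_eq_of_not hs with hd | hd <;> rw [hd] <;> simp [seminormalCoeff_neg_one]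

theorem Generic.youngOp_sq (h : Generic n q) (i : Fin (n - 1)) :
    youngOp n q μ i * youngOp n q μ i = youngOp n q μ i := by
  refine end_ext fun f hf => ?_
  have h1 := seminormalCoeff_add_neg h.ne_zero h.one_add_ne (h.zpow_fillDist hf i)
  have h2 := coeff_mul_neg (q := q) hf i
  simp only [Module.End.mul_apply, youngOp_tabVec', map_smul, map_add, stdInd_of hf,
    fillDist_swapFill_self, swapFill_swapFill, one_smul]
  have h3 : stdInd (swapFill i f) • tabVec (swapFill i f) = tabVec (swapFill i f) := by
    by_cases hs : IsStd (swapFill i f)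
    · rw [stdInd_of hs, one_smul]
    · rw [tabVec_of_not hs, smul_zero]
  generalize seminormalCoeff q (fillDist f i) = a at *
  generalize seminormalCoeff q (-fillDist f i) = b at *
  generalize tabVec (swapFill i f) = w at *
  generalize stdInd (swapFill i f) = s at *
  have hb : b = 1 - a := by linear_combination h1
  subst hb
  match_scalars
  · linear_combination h2
  · ring

theorem youngOp_comm {i j : Fin (n - 1)} (hij : (i : ℕ) + 1 < j) :
    youngOp n q μ i * youngOp n q μ j = youngOp n q μ j * youngOp n q μ i := by
  refine end_ext fun f hf => ?_
  have hw : stdInd (swapFill i f) • tabVec (swapFill i (swapFill j f)) =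
      stdInd (swapFill j f) • tabVec (swapFill i (swapFill j f)) := by
    by_cases hs : IsStd (swapFill i (swapFill j f))
    · obtain ⟨h1, h2⟩ := isStd_of_far hij hf hs
      rw [stdInd_of h1, stdInd_of h2]
    · rw [tabVec_of_not hs]; simp
  simp only [Module.End.mul_apply, youngOp_tabVec', map_smul, map_add, stdInd_of hf, one_smul,
    fillDist_swapFill_far f (Or.inl hij), fillDist_swapFill_far f (Or.inr hij), ← hw,
    ← swap_comm_of_far hij]
  module

theorem Generic.youngOp_braid (h : Generic n q) {i j : Fin (n - 1)} (hij : (i : ℕ) + 1 = j) :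
    youngOp n q μ i * youngOp n q μ j * youngOp n q μ i - (q / (1 + q) ^ 2) • youngOp n q μ i =
    youngOp n q μ j * youngOp n q μ i * youngOp n q μ j - (q / (1 + q) ^ 2) • youngOp n q μ j := by
  refine end_ext fun f hf => ?_
  have hu := h.zpow_fillDist hf i
  have hv := h.zpow_fillDist hf j
  have huv := h.zpow_ne i (hf.fillDist_add_ne_zero hij) (abs_fillDist_add_lt f hij).le
  have b1 := seminormalCoeff_braid h.ne_zero h.one_add_ne hu hv huv
  have b2 := seminormalCoeff_braid h.ne_zero h.one_add_ne hv hu (by rwa [add_comm])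
  have c1 := coeff_mul_neg (q := q) hf i
  have c2 := coeff_mul_neg (q := q) hf j
  -- The two sides reach the reversed filling along different paths, hence with different
  -- indicators; all of these are 1 when that filling is standard.
  have hw : (stdInd (swapFill i f) * stdInd (swapFill j (swapFill i f))) •
        tabVec (swapFill i (swapFill j (swapFill i f))) =
      (stdInd (swapFill j f) * stdInd (swapFill i (swapFill j f))) •
        tabVec (swapFill i (swapFill j (swapFill i f))) := by
    by_cases hs : IsStd (swapFill i (swapFill j (swapFill i f)))
    · obtain ⟨h1, h2, h3, h4⟩ := isStd_of_braid hij hf hs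
      rw [stdInd_of h1, stdInd_of h2, stdInd_of h3, stdInd_of h4]
    · rw [tabVec_of_not hs]; simp
  simp only [LinearMap.sub_apply, LinearMap.smul_apply,
    Module.End.mul_apply, youngOp_tabVec', map_smul, map_add, stdInd_of hf, one_smul,
    fillDist_swapFill_self, fillDist_swapFill_succ _ hij, fillDist_swapFill_pred _ hij,
    neg_add_cancel_left, add_neg_cancel_right,
    swapFill_swapFill, ← swap_braid hij]
  rw [add_comm (fillDist f j)] at b2
  generalize fillDist f i = u at *
  generalize fillDist f j = v at *
  generalize tabVec (swapFill i (swapFill j (swapFill i f))) = w at *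
  have hw' := congrArg (fun x => (seminormalCoeff q u * seminormalCoeff q v *
    seminormalCoeff q (u + v)) • x) hw
  rw [← sub_eq_zero] at hw' ⊢
  rw [← hw']
  -- One scalar identity for each of the six arrangements of the three entries. The first three use
  -- the quadratic and braid identities for the coefficients; the others are formal.
  match_scalars
  · linear_combination seminormalCoeff q (u + v) * c1 - seminormalCoeff q (u + v) * c2 +
      seminormalCoeff q u * b1 - seminormalCoeff q v * b2
  · linear_combination seminormalCoeff q u * b1
  · linear_combination - seminormalCoeff q v * b2
  · ring
  · ring
  · ring

end Seminormal

/-! ### Homomorphisms from the Hecke algebra -/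

section Lift

variable {n : ℕ} {q : ℂ} {A : Type*} [Ring A] [Algebra ℂ A]

/-- Elements which satisfy the defining relations of the generators of `H_n(q)`. -/
structure HeckeRel (n : ℕ) (q : ℂ) (g : Fin (n - 1) → A) : Prop where
  sq : ∀ i, g i ^ 2 = (q - 1) • g i + q • 1
  comm : ∀ i j : Fin (n - 1), (i : ℕ) + 1 < j → g i * g j = g j * g i
  braid : ∀ i j : Fin (n - 1), (i : ℕ) + 1 = j → g i * g j * g i = g j * g i * g j

/-- The unit given by an element which satisfies the quadratic relation. -/
def HeckeRel.unit {g : Fin (n - 1) → A} (h : HeckeRel n q g) (hq0 : q ≠ 0) (i : Fin (n - 1)) :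
    Aˣ where
  val := g i
  inv := q⁻¹ • (g i - (q - 1) • 1)
  val_inv := by
    have := h.sq i
    rw [pow_two] at this
    rw [mul_smul_comm, mul_sub, this, mul_smul_comm, mul_one, add_sub_cancel_left, smul_smul,
      inv_mul_cancel₀ hq0, one_smul]
  inv_val := by
    have := h.sq i
    rw [pow_two] at this
    rw [smul_mul_assoc, sub_mul, this, smul_mul_assoc, one_mul, add_sub_cancel_left, smul_smul,
      inv_mul_cancel₀ hq0, one_smul]

theorem HeckeRel.unit_rel {g : Fin (n - 1) → A} (h : HeckeRel n q g) (hq0 : q ≠ 0) :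
    ∀ r ∈ braidRels n, FreeGroup.lift (h.unit hq0) r = 1 := by
  rintro r (⟨i, j, hij, rfl⟩ | ⟨i, j, hij, rfl⟩)
  · simp only [map_mul, map_inv, FreeGroup.lift_apply_of]
    rw [mul_inv_eq_one]
    exact Units.ext (h.comm i j hij)
  · simp only [map_mul, map_inv, FreeGroup.lift_apply_of]
    rw [mul_inv_eq_one]
    exact Units.ext (h.braid i j hij)

/-- The homomorphism `ℂ[B_n] → A` given by elements satisfying the defining relations. -/
def HeckeRel.preLift {g : Fin (n - 1) → A} (h : HeckeRel n q g) (hq0 : q ≠ 0) :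
    MonoidAlgebra ℂ (BraidGroup n) →ₐ[ℂ] A :=
  MonoidAlgebra.lift ℂ _ (BraidGroup n)
    ((Units.coeHom A).comp (PresentedGroup.toGroup (h.unit_rel hq0)))

theorem HeckeRel.preLift_braidGen {g : Fin (n - 1) → A} (h : HeckeRel n q g) (hq0 : q ≠ 0)
    (i : Fin (n - 1)) : h.preLift hq0 (braidGen n i) = g i := by
  simp only [preLift, braidGen, MonoidAlgebra.lift_of, MonoidHom.comp_apply,
    PresentedGroup.toGroup.of]
  rfl

theorem HeckeRel.preLift_rel {g : Fin (n - 1) → A} (h : HeckeRel n q g) (hq0 : q ≠ 0)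
    ⦃x y : MonoidAlgebra ℂ (BraidGroup n)⦄ (hxy : QuadRel n q x y) :
    h.preLift hq0 x = h.preLift hq0 y := by
  obtain ⟨i⟩ := hxy
  simp only [map_pow, map_add, map_smul, map_one, h.preLift_braidGen, h.sq]

/-- The universal property of the Hecke algebra. -/
def HeckeRel.lift {g : Fin (n - 1) → A} (h : HeckeRel n q g) (hq0 : q ≠ 0) :
    HeckeAlgebra n q →ₐ[ℂ] A :=
  RingQuot.liftAlgHom ℂ ⟨h.preLift hq0, h.preLift_rel hq0⟩

theorem HeckeRel.lift_gen {g : Fin (n - 1) → A} (h : HeckeRel n q g) (hq0 : q ≠ 0)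
    (i : Fin (n - 1)) : h.lift hq0 (gen n q i) = g i :=
  (RingQuot.liftAlgHom_mkAlgHom_apply ℂ _ (h.preLift_rel hq0) _).trans
    (h.preLift_braidGen hq0 i)

/-- For idempotents, the two sides of the braid relation for $g=(1+q)e-1$ differ by $(1+q)^3$ times
the difference of the two sides of the third hypothesis. -/
theorem heckeRel_of_idem (hq1 : 1 + q ≠ 0) {e : Fin (n - 1) → A} (h1 : ∀ i, e i * e i = e i)
    (h2 : ∀ i j : Fin (n - 1), (i : ℕ) + 1 < j → e i * e j = e j * e i)
    (h3 : ∀ i j : Fin (n - 1), (i : ℕ) + 1 = j →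
      e i * e j * e i - (q / (1 + q) ^ 2) • e i = e j * e i * e j - (q / (1 + q) ^ 2) • e j) :
    HeckeRel n q fun i => (1 + q) • e i - 1 where
  sq i := by
    simp only [pow_two, mul_sub, sub_mul, smul_mul_assoc, mul_smul_comm, h1, mul_one, one_mul]
    module
  comm i j hij := by
    simp only [mul_sub, sub_mul, smul_mul_assoc, mul_smul_comm, mul_one, one_mul, h2 i j hij]
    module
  braid i j hij := by
    have h := h3 i j hij
    simp only [mul_sub, sub_mul, smul_mul_assoc, mul_smul_comm, h1, mul_one, one_mul]
    have h' := congrArg (fun x => (1 + q) ^ 3 • x) h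
    simp only [smul_sub, smul_smul] at h'
    rw [show (1 + q) ^ 3 * (q / (1 + q) ^ 2) = (1 + q) * q by field_simp] at h'
    rw [← sub_eq_zero] at h' ⊢
    rw [← h']
    module

end Lift

/-- The representation `π_μ`. -/
def youngRep {n : ℕ} {q : ℂ} (h : Generic n q) (μ : YoungDiagram) :
    HeckeAlgebra n q →ₐ[ℂ] Module.End ℂ (StdTableau n μ →₀ ℂ) :=
  (heckeRel_of_idem h.one_add_ne (e := youngOp n q μ) h.youngOp_sq
    (fun _ _ hij => youngOp_comm hij) (fun _ _ hij => h.youngOp_braid hij)).lift h.ne_zero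

theorem youngRep_gen {n : ℕ} {q : ℂ} (h : Generic n q) (μ : YoungDiagram) (i : Fin (n - 1)) :
    youngRep h μ (gen n q i) = (1 + q) • youngOp n q μ i - 1 :=
  HeckeRel.lift_gen _ _ i

theorem youngRep_idem {n : ℕ} {q : ℂ} (h : Generic n q) (μ : YoungDiagram) (i : Fin (n - 1)) :
    youngRep h μ (idem n q i) = youngOp n q μ i := by
  have := h.one_add_ne
  rw [idem, map_smul, map_add, map_one, youngRep_gen, add_sub_cancel (1 : Module.End ℂ (StdTableau n μ →₀ ℂ)), smul_smul, add_comm q 1,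
    inv_mul_cancel₀ this, one_smul]

/-! ### Structure of the Hecke algebra -/

section Structure

variable {n : ℕ} {q : ℂ}

theorem gen_comm {i j : Fin (n - 1)} (hij : (i : ℕ) + 1 < j) :
    gen n q i * gen n q j = gen n q j * gen n q i := by
  have := PresentedGroup.one_of_mem (rels := braidRels n) (Or.inl ⟨i, j, hij, rfl⟩)
  simp only [map_mul, map_inv] at this
  have h := congrArg (fun x => mk n q (MonoidAlgebra.of ℂ (BraidGroup n) x))
    (mul_inv_eq_one.mp this)
  rw [map_mul, map_mul, map_mul, map_mul] at h
  exact h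

theorem gen_braid {i j : Fin (n - 1)} (hij : (i : ℕ) + 1 = j) :
    gen n q i * gen n q j * gen n q i = gen n q j * gen n q i * gen n q j := by
  have := PresentedGroup.one_of_mem (rels := braidRels n) (Or.inr ⟨i, j, hij, rfl⟩)
  simp only [map_mul, map_inv] at this
  have h := congrArg (fun x => mk n q (MonoidAlgebra.of ℂ (BraidGroup n) x))
    (mul_inv_eq_one.mp this)
  rw [map_mul, map_mul, map_mul, map_mul, map_mul, map_mul, map_mul, map_mul] at h
  exact h

/-- A left ideal of `H_n(q)` is the whole algebra if it contains `1` and is stable under left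
multiplication by the generators. -/
theorem submodule_eq_top (hq0 : q ≠ 0) (W : Submodule ℂ (HeckeAlgebra n q)) (h1 : 1 ∈ W)
    (hg : ∀ i, ∀ x ∈ W, gen n q i * x ∈ W) : W = ⊤ := by
  -- Braid words also involve inverse generators; by the quadratic relation
  -- $g^{-1}=q^{-1}(g-(q-1))$, so these preserve `W` too.
  have hinv : ∀ b ∈ Subgroup.closure (Set.range (PresentedGroup.of (rels := braidRels n))),
      ∀ x ∈ W, mk n q (MonoidAlgebra.of ℂ _ b) * x ∈ W ∧
        mk n q (MonoidAlgebra.of ℂ _ b⁻¹) * x ∈ W := by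
    intro b hb
    induction hb using Subgroup.closure_induction with
    | mem b hb =>
      obtain ⟨i, rfl⟩ := hb
      intro x hx
      refine ⟨hg i x hx, ?_⟩
      have e : mk n q (MonoidAlgebra.of ℂ _ (PresentedGroup.of i : BraidGroup n)⁻¹) =
          q⁻¹ • (gen n q i - (q - 1) • 1) := by
        have e1 : gen n q i * (q⁻¹ • (gen n q i - (q - 1) • 1)) = 1 := by
          have := gen_sq n q i
          rw [pow_two] at this
          rw [mul_smul_comm, mul_sub, this, mul_smul_comm, mul_one, add_sub_cancel_left,
            smul_smul, inv_mul_cancel₀ hq0, one_smul]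
        have e2 : mk n q (MonoidAlgebra.of ℂ _ (PresentedGroup.of i : BraidGroup n)⁻¹) *
            gen n q i = 1 := by
          rw [gen, braidGen, ← map_mul, ← map_mul, inv_mul_cancel, map_one, map_one]
        exact left_inv_eq_right_inv e2 e1
      rw [e, smul_mul_assoc, sub_mul, smul_mul_assoc, one_mul]
      exact W.smul_mem _ (W.sub_mem (hg i x hx) (W.smul_mem _ hx))
    | one =>
      intro x hx
      rw [inv_one, map_one, map_one, one_mul]
      exact ⟨hx, hx⟩
    | mul a b _ _ ha hb =>
      intro x hx
      rw [mul_inv_rev, map_mul, map_mul, map_mul, map_mul, mul_assoc, mul_assoc]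
      exact ⟨(ha _ (hb _ hx).1).1, (hb _ (ha _ hx).2).2⟩
    | inv a _ ha =>
      intro x hx
      rw [inv_inv]
      exact (ha x hx).symm
  rw [eq_top_iff]
  rintro y -
  obtain ⟨z, rfl⟩ := RingQuot.mkAlgHom_surjective ℂ (QuadRel n q) y
  change mk n q z ∈ W
  induction z using MonoidAlgebra.induction_on with
  | of b =>
    have := (hinv b (by rw [PresentedGroup.closure_range_of]; trivial) 1 h1).1
    rwa [mul_one] at this
  | add x y hx hy => rw [map_add]; exact W.add_mem hx hy
  | smul c x hx => rw [map_smul]; exact W.smul_mem _ hx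

end Structure

/-! ### Normal forms in $H_{n+1}(q)$ over $\sigma(H_n(q))$ and the dimension bound -/

section DescWord

variable {n : ℕ} {q : ℂ}

theorem descWord_zero : descWord n q 0 = 1 := by
  simp [descWord]

theorem descWord_succ {j : ℕ} (hj : j < n) :
    descWord n q ⟨j + 1, by omega⟩ =
      gen (n + 1) q ⟨j, by omega⟩ * descWord n q ⟨j, by omega⟩ := by
  simp only [descWord]
  rw [List.ofFn_succ', List.concat_eq_append, List.reverse_append]
  simp

theorem gen_mul_descWord_of_lt {i j : ℕ} (hi : i < n) (hj : j ≤ n) (hij : j < i) :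
    gen (n + 1) q ⟨i, by omega⟩ * descWord n q ⟨j, by omega⟩ =
      descWord n q ⟨j, by omega⟩ * gen (n + 1) q ⟨i, by omega⟩ := by
  induction j with
  | zero => simp only [Fin.mk_zero', descWord_zero, one_mul, mul_one]
  | succ j ih =>
    rw [descWord_succ (by omega), ← mul_assoc, ← gen_comm (by simpa using hij), mul_assoc,
      ih (by omega) (by omega), mul_assoc]

/-- The generator commutes past the larger letters, and the braid relation raises its index by one
when it meets its two neighbouring letters. It leaves on the right as an element of the image of
$\sigma$. -/
theorem gen_mul_descWord_of_gt {i j : ℕ} (hj : j ≤ n) (hij : i + 1 < j) :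
    gen (n + 1) q ⟨i, by omega⟩ * descWord n q ⟨j, by omega⟩ =
      descWord n q ⟨j, by omega⟩ * gen (n + 1) q ⟨i + 1, by omega⟩ := by
  induction j with
  | zero => omega
  | succ j ih =>
    rcases Nat.lt_or_ge (i + 1) j with h | h
    · rw [descWord_succ (by omega), ← mul_assoc, gen_comm (by simpa using h), mul_assoc,
        ih (by omega) h, mul_assoc]
    · obtain rfl : j = i + 1 := by omega
      rw [descWord_succ (by omega), descWord_succ (by omega), ← mul_assoc, ← mul_assoc,
        gen_braid rfl, mul_assoc, mul_assoc,
        gen_mul_descWord_of_lt (by omega) (by omega) (by omega)]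
      simp only [mul_assoc]

theorem gen_mul_descWord_succ {j : ℕ} (hj : j < n) :
    gen (n + 1) q ⟨j, by omega⟩ * descWord n q ⟨j + 1, by omega⟩ =
      (q - 1) • descWord n q ⟨j + 1, by omega⟩ + q • descWord n q ⟨j, by omega⟩ := by
  rw [descWord_succ hj, ← mul_assoc, ← pow_two, gen_sq, add_mul, smul_mul_assoc, smul_mul_assoc,
    one_mul]

theorem sigma_gen {i : ℕ} (hi : i < n - 1) :
    sigma n q (gen n q ⟨i, hi⟩) = gen (n + 1) q ⟨i + 1, by omega⟩ :=
  shift_gen q _ _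

/-- The span of the products of descending words with elements of `σ(H_n(q))`. -/
def descMap (n : ℕ) (q : ℂ) : (Fin (n + 1) → HeckeAlgebra n q) →ₗ[ℂ] HeckeAlgebra (n + 1) q :=
  LinearMap.lsum ℂ (fun _ => HeckeAlgebra n q) ℂ fun j =>
    (LinearMap.mulLeft ℂ (descWord n q j)).comp (sigma n q).toLinearMap

theorem descMap_apply (x : Fin (n + 1) → HeckeAlgebra n q) :
    descMap n q x = ∑ j, descWord n q j * sigma n q (x j) := by
  simp [descMap, LinearMap.lsum_apply]

theorem descWord_mul_mem (j : ℕ) (hj : j < n + 1) (x : HeckeAlgebra n q) :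
    descWord n q ⟨j, hj⟩ * sigma n q x ∈ LinearMap.range (descMap n q) := by
  refine ⟨Pi.single ⟨j, hj⟩ x, ?_⟩
  rw [descMap_apply, Finset.sum_eq_single ⟨j, hj⟩]
  · simp
  · intro b _ hb; simp [hb]
  · simp

/-- A generator lengthens the word, meets its leading letter (quadratic relation), or passes through
it into $\sigma(H_n(q))$. -/
theorem gen_descWord_mem (i : ℕ) (hi : i < n) (j : ℕ) (hj : j < n + 1) (x : HeckeAlgebra n q) :
    gen (n + 1) q ⟨i, hi⟩ * (descWord n q ⟨j, hj⟩ * sigma n q x) ∈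
      LinearMap.range (descMap n q) := by
  rw [← mul_assoc]
  rcases lt_trichotomy i j with h | rfl | h
  · rcases (by omega : j = i + 1 ∨ i + 1 < j) with rfl | h
    · rw [gen_mul_descWord_succ hi, add_mul, smul_mul_assoc, smul_mul_assoc]
      exact Submodule.add_mem _ (Submodule.smul_mem _ _ (descWord_mul_mem _ _ _))
        (Submodule.smul_mem _ _ (descWord_mul_mem _ _ _))
    · rw [gen_mul_descWord_of_gt (by omega) h, mul_assoc, ← sigma_gen (by omega), ← map_mul]
      exact descWord_mul_mem _ _ _
  · rw [← descWord_succ hi]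
    exact descWord_mul_mem _ _ _
  · obtain ⟨i, rfl⟩ : ∃ m, i = m + 1 := ⟨i - 1, by omega⟩
    rw [gen_mul_descWord_of_lt hi (by omega) h, mul_assoc, ← sigma_gen (by omega), ← map_mul]
    exact descWord_mul_mem _ _ _

theorem descMap_surjective (hq0 : q ≠ 0) : Function.Surjective (descMap n q) := by
  rw [← LinearMap.range_eq_top]
  refine submodule_eq_top hq0 _ ?_ ?_
  · have := descWord_mul_mem (n := n) (q := q) 0 (by omega) 1
    simpa [descWord_zero] using this
  · rintro i _ ⟨x, rfl⟩
    rw [descMap_apply, Finset.mul_sum]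
    exact Submodule.sum_mem _ fun j _ => gen_descWord_mem i i.2 j j.2 _

/-- Since $H_{n+1}(q)$ is spanned by $n+1$ translates of $\sigma(H_n(q))$, each step multiplies the
bound by $n+1$. Injectivity of $\sigma$ plays no role. -/
theorem finrank_le_factorial (hq0 : q ≠ 0) (n : ℕ) :
    Module.Finite ℂ (HeckeAlgebra n q) ∧
      Module.finrank ℂ (HeckeAlgebra n q) ≤ n.factorial := by
  induction n with
  | zero =>
    have hs : Function.Surjective (LinearMap.toSpanSingleton ℂ (HeckeAlgebra 0 q) 1) := by
      rw [← LinearMap.range_eq_top]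
      refine submodule_eq_top hq0 _ ⟨1, by simp⟩ ?_
      intro i
      exact absurd i.2 (by omega)
    refine ⟨Module.Finite.of_surjective _ hs, ?_⟩
    simpa using LinearMap.finrank_le_finrank_of_surjective hs
  | succ n ih =>
    obtain ⟨h1, h2⟩ := ih
    have hs := descMap_surjective (n := n) hq0
    refine ⟨Module.Finite.of_surjective _ hs, ?_⟩
    refine (LinearMap.finrank_le_finrank_of_surjective hs).trans ?_
    rw [Module.finrank_pi_fintype, Nat.factorial_succ]
    simpa using Nat.mul_le_mul_left (n + 1) h2

end DescWord

/-! ### Symmetrizers and antisymmetrizers -/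

section Symmetrizers

variable {q : ℂ}

/-- A weighted sum of descending words is an eigenvector of the generators. -/
theorem gen_mul_sum_descWord (n : ℕ) (c e : ℂ) (hce : 1 + c * (q - 1) = e * c) (hec : c * q = e)
    (x : HeckeAlgebra n q) (hx : ∀ i, gen n q i * x = e • x) (i : Fin (n + 1 - 1)) :
    gen (n + 1) q i * ∑ j : Fin (n + 1), c ^ (j : ℕ) • (descWord n q j * sigma n q x) =
      e • ∑ j : Fin (n + 1), c ^ (j : ℕ) • (descWord n q j * sigma n q x) := by
  obtain ⟨i, hi⟩ := i
  have hin : i < n := hi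
  have hx' : ∀ m (hm : m < n - 1), gen (n + 1) q ⟨m + 1, by omega⟩ * sigma n q x =
      e • sigma n q x := by
    intro m hm
    rw [← sigma_gen hm, ← map_mul, hx, map_smul]
  rw [Finset.mul_sum, Finset.smul_sum]
  have hne : (⟨i, by omega⟩ : Fin (n + 1)) ≠ ⟨i + 1, by omega⟩ := by simp
  -- Only the words of length $i$ and $i+1$ are mixed by the generator, and comparing their
  -- coefficients gives `hce` and `hec`. Through every other word the generator passes to act on
  -- `x`.
  rw [← Finset.sum_add_sum_compl {(⟨i, by omega⟩ : Fin (n + 1)), ⟨i + 1, by omega⟩},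
    ← Finset.sum_add_sum_compl {(⟨i, by omega⟩ : Fin (n + 1)), ⟨i + 1, by omega⟩} (fun j => e • _)]
  congr 1
  · rw [Finset.sum_pair hne, Finset.sum_pair hne]
    simp only [mul_smul_comm]
    rw [← mul_assoc, ← mul_assoc, ← descWord_succ hin, gen_mul_descWord_succ hin, add_mul,
      smul_mul_assoc, smul_mul_assoc]
    match_scalars
    · rw [pow_succ]; linear_combination c ^ i * hce
    · rw [pow_succ]; linear_combination c ^ i * hec
  · refine Finset.sum_congr rfl ?_
    rintro ⟨j, hj⟩ hmem
    simp only [Finset.mem_compl, Finset.mem_insert, Finset.mem_singleton, Fin.mk.injEq,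
      not_or] at hmem
    rw [mul_smul_comm, smul_comm e, ← mul_assoc]
    congr 1
    rcases (by omega : i + 1 < j ∨ j < i) with h | h
    · rw [gen_mul_descWord_of_gt (by omega) h, mul_assoc, hx' i (by omega), mul_smul_comm]
    · obtain ⟨i, rfl⟩ : ∃ m, i = m + 1 := ⟨i - 1, by omega⟩
      rw [gen_mul_descWord_of_lt hin (by omega) h, mul_assoc, hx' i (by omega), mul_smul_comm]

theorem gen_mul_posA (k : ℕ) (i : Fin (k - 1)) : gen k q i * posA q k = q • posA q k := by
  induction k with
  | zero => exact absurd i.2 (by omega)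
  | succ k ih =>
    have := gen_mul_sum_descWord k 1 q (by ring) (by ring) (posA q k) ih i
    simpa only [posA, one_pow, one_smul] using this

theorem gen_mul_negA (hq0 : q ≠ 0) (k : ℕ) (i : Fin (k - 1)) :
    gen k q i * negA q k = (-1 : ℂ) • negA q k := by
  induction k with
  | zero => exact absurd i.2 (by omega)
  | succ k ih =>
    exact gen_mul_sum_descWord k (-q⁻¹) (-1) (by field_simp; ring) (by field_simp) (negA q k) ih i

theorem qFactorial_succ (q : ℂ) (k : ℕ) :
    qFactorial q (k + 1) = qFactorial q k * ∑ i ∈ Finset.range (k + 1), q ^ i :=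
  Finset.prod_range_succ _ _

variable {V : Type*} [AddCommGroup V] [Module ℂ V]

theorem map_descWord_apply {n : ℕ} (ρ : HeckeAlgebra (n + 1) q →ₐ[ℂ] Module.End ℂ V) {e : ℂ} {v : V}
    (hv : ∀ i, ρ (gen (n + 1) q i) v = e • v) (j : ℕ) (hj : j < n + 1) :
    ρ (descWord n q ⟨j, hj⟩) v = e ^ j • v := by
  induction j with
  | zero => simp [descWord_zero]
  | succ j ih =>
    rw [descWord_succ (by omega), map_mul, Module.End.mul_apply, ih (by omega), map_smul, hv,
      smul_smul, pow_succ]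

/-- On a common eigenvector the word of length $j$ acts by $q^j$, so passing from $k$ to $k+1$
contributes the factor $1+q+\dots+q^k$. -/
theorem map_posA_apply (k : ℕ) (ρ : HeckeAlgebra k q →ₐ[ℂ] Module.End ℂ V) {v : V}
    (hv : ∀ i, ρ (gen k q i) v = q • v) : ρ (posA q k) v = qFactorial q k • v := by
  induction k with
  | zero => simp [posA, qFactorial]
  | succ k ih =>
    have h := ih (ρ.comp (sigma k q)) fun i => by
      rw [AlgHom.comp_apply, shift_gen, hv]
    simp only [AlgHom.comp_apply] at h
    simp only [posA, map_sum, map_mul, LinearMap.sum_apply, Module.End.mul_apply, h, map_smul]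
    have hd : ∀ j : Fin (k + 1), ρ (descWord k q j) v = q ^ (j : ℕ) • v := fun j =>
      map_descWord_apply ρ hv j j.2
    simp only [hd, smul_smul]
    rw [← Finset.sum_smul, ← Finset.mul_sum, qFactorial_succ,
      Fin.sum_univ_eq_sum_range (fun j => q ^ j)]

theorem map_negA_apply (k : ℕ) (ρ : HeckeAlgebra k q →ₐ[ℂ] Module.End ℂ V) {v : V}
    (hv : ∀ i, ρ (gen k q i) v = (-1 : ℂ) • v) : ρ (negA q k) v = qFactorial q⁻¹ k • v := by
  induction k with
  | zero => simp [negA, qFactorial]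
  | succ k ih =>
    have h := ih (ρ.comp (sigma k q)) fun i => by
      rw [AlgHom.comp_apply, shift_gen, hv]
    simp only [AlgHom.comp_apply] at h
    simp only [negA, map_sum, map_mul, LinearMap.sum_apply, Module.End.mul_apply, h, map_smul,
      LinearMap.smul_apply]
    have hd : ∀ j : Fin (k + 1), ρ (descWord k q j) v = (-1 : ℂ) ^ (j : ℕ) • v := fun j =>
      map_descWord_apply ρ hv j j.2
    simp only [hd, smul_smul]
    -- The sign from the eigenvalue $-1$ cancels the sign of the weight, leaving powers of $q^{-1}$.
    have hpow : ∀ j : ℕ, (-q⁻¹) ^ j * (qFactorial q⁻¹ k * (-1) ^ j) =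
        qFactorial q⁻¹ k * q⁻¹ ^ j := by
      intro j
      rw [mul_left_comm, ← mul_pow]
      simp
    simp only [hpow]
    rw [← Finset.sum_smul, ← Finset.mul_sum, qFactorial_succ,
      Fin.sum_univ_eq_sum_range (fun j => q⁻¹ ^ j)]

end Symmetrizers

/-! ### Counting standard tableaux -/

section Diagrams

theorem lt_card_of_mem {μ : YoungDiagram} {c : ℕ × ℕ} (hc : c ∈ μ) : c.1 + c.2 < μ.card := by
  change c.1 + c.2 < μ.cells.card
  have := hook_le_card μ.cells (c.2 + 1) c.1
    (fun j hj => μ.up_left_mem (i2 := c.1) (j2 := c.2) (by omega) (by omega) hc)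
    (fun j hj => μ.up_left_mem (i2 := c.1) (j2 := c.2) (by omega) (by omega) hc)
  omega

instance (n : ℕ) : Finite (Diagram n) := by
  refine Finite.of_injective (β := {s // s ∈ (Finset.range n ×ˢ Finset.range n).powerset})
    (fun μ => ⟨μ.1.cells, ?_⟩) ?_
  · rw [Finset.mem_powerset]
    intro c hc
    have := lt_card_of_mem (μ := μ.1) hc
    rw [μ.2] at this
    simp only [Finset.mem_product, Finset.mem_range]
    omega
  · intro μ ν h
    exact Subtype.ext (YoungDiagram.ext (congrArg Subtype.val h))

instance (n : ℕ) : Fintype (Diagram n) := Fintype.ofFinite _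

instance (n : ℕ) (μ : YoungDiagram) : Finite (StdTableau n μ) :=
  Finite.of_injective (fun t => t.pos) fun _ _ h => StdTableau.ext h

instance (n : ℕ) (μ : YoungDiagram) : Fintype (StdTableau n μ) := Fintype.ofFinite _

theorem exists_insert {κ μ : YoungDiagram} (h : κ ≤ μ) (hc : μ.card = κ.card + 1) :
    ∃ c, c ∉ κ.cells ∧ insert c κ.cells = μ.cells :=
  (Finset.exists_eq_insert_iff).mpr ⟨h, hc.symm⟩

/-- The diagram with one more square. -/
def insertCell (μ : YoungDiagram) (c : ℕ × ℕ) (hc : ∀ x, x < c → x ∈ μ.cells) : YoungDiagram where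
  cells := insert c μ.cells
  isLowerSet := by
    intro a b hba ha
    simp only [Finset.coe_insert, Set.mem_insert_iff, Finset.mem_coe] at ha ⊢
    rcases ha with rfl | ha
    · rcases eq_or_lt_of_le hba with h | h
      · exact Or.inl h
      · exact Or.inr (hc _ h)
    · exact Or.inr (μ.isLowerSet hba ha)

/-- A minimal cell of the difference can be added to the smaller diagram. -/
theorem exists_between {κ μ : YoungDiagram} (h : κ < μ) :
    ∃ ν : YoungDiagram, κ ≤ ν ∧ ν ≤ μ ∧ ν.card = κ.card + 1 := by
  have hne : (μ.cells \ κ.cells).Nonempty := by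
    rw [Finset.sdiff_nonempty]
    intro h'
    exact absurd (show μ ≤ κ from h') (not_le_of_gt h)
  obtain ⟨c, hc⟩ := Finset.exists_minimal hne
  have hcm := hc.prop
  rw [Finset.mem_sdiff] at hcm
  refine ⟨insertCell κ c ?_, ?_, ?_, ?_⟩
  · intro x hx
    by_contra hxk
    exact hc.not_lt (Finset.mem_sdiff.mpr ⟨μ.isLowerSet hx.le hcm.1, hxk⟩) hx
  · exact Finset.subset_insert _ _
  · exact Finset.insert_subset hcm.1 h.le
  · exact Finset.card_insert_of_notMem hcm.2

/-- The new largest entry goes into the one additional cell, which lies below no cell of the smaller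
diagram. -/
theorem exists_extend {n : ℕ} {κ μ : YoungDiagram} (h : κ ≤ μ) (hc : μ.card = κ.card + 1)
    (t : StdTableau n κ) :
    ∃ s : StdTableau (n + 1) μ, ∀ a : Fin n, (s.pos a.castSucc : ℕ × ℕ) = t.pos a := by
  obtain ⟨c, hcκ, hins⟩ := exists_insert h hc
  have hcμ : c ∈ μ.cells := hins ▸ Finset.mem_insert_self _ _
  let g : Fin (n + 1) → {c // c ∈ μ.cells} :=
    Fin.snoc (α := fun _ => {c // c ∈ μ.cells}) (fun a : Fin n => ⟨t.pos a, h (t.pos a).2⟩) ⟨c, hcμ⟩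
  have g1 : ∀ a : Fin n, (g a.castSucc : ℕ × ℕ) = t.pos a := fun a => by simp [g]
  have g2 : (g (Fin.last n) : ℕ × ℕ) = c := by simp [g]
  have hinj : Function.Injective g := by
    intro a b hab
    have hab' : (g a : ℕ × ℕ) = g b := congrArg _ hab
    induction a using Fin.lastCases with
    | last =>
      induction b using Fin.lastCases with
      | last => rfl
      | cast b =>
        rw [g1, g2] at hab'
        exact absurd (hab' ▸ (t.pos b).2) hcκ
    | cast a =>
      induction b using Fin.lastCases with
      | last =>
        rw [g1, g2] at hab'
        exact absurd (hab' ▸ (t.pos a).2) hcκ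
      | cast b =>
        rw [g1, g1] at hab'
        rw [t.pos.injective (Subtype.ext hab')]
  have hbij : Function.Bijective g := by
    rw [Fintype.bijective_iff_injective_and_card]
    refine ⟨hinj, ?_⟩
    have := card_of_filling t.pos
    have hc' : μ.cells.card = κ.cells.card + 1 := hc
    have h2 : κ.cells.card = n := this
    simp [hc', h2]
  refine ⟨⟨Equiv.ofBijective g hbij, ?_⟩, g1⟩
  intro a b hab
  simp only [Equiv.ofBijective_apply] at hab
  induction b using Fin.lastCases with
  | last => exact Fin.le_last a
  | cast b =>
    induction a using Fin.lastCases with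
    | last =>
      rw [g1, g2] at hab
      exact absurd (κ.isLowerSet hab (t.pos b).2) hcκ
    | cast a =>
      rw [g1, g1] at hab
      exact Fin.castSucc_le_castSucc_iff.mpr (t.standard a b hab)

theorem exists_extend_of_le {m n : ℕ} {κ μ : YoungDiagram} (h : κ ≤ μ) (hn : μ.card = n)
    (t : StdTableau m κ) :
    ∃ s : StdTableau n μ, ∀ (a : ℕ) (ha : a < m) (ha' : a < n),
      (s.pos ⟨a, ha'⟩ : ℕ × ℕ) = t.pos ⟨a, ha⟩ := by
  have hκ : κ.card = m := card_of_filling t.pos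
  have hle : κ.card ≤ μ.card := Finset.card_le_card h
  obtain ⟨d, hd⟩ : ∃ d, n = m + d := ⟨n - m, by omega⟩
  induction d generalizing m κ with
  | zero =>
    obtain rfl : κ = μ := YoungDiagram.ext (Finset.eq_of_subset_of_card_le h (by
      change μ.card ≤ κ.card; omega))
    obtain rfl : m = n := by omega
    exact ⟨t, fun _ _ _ => rfl⟩
  | succ d ih =>
    have hlt : κ < μ := lt_of_le_of_ne h (by rintro rfl; omega)
    obtain ⟨ν, h1, h2, h3⟩ := exists_between hlt
    obtain ⟨s, hs⟩ := exists_extend h1 h3 t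
    obtain ⟨s', hs'⟩ := ih h2 s (card_of_filling s.pos) (Finset.card_le_card h2) (by omega)
    refine ⟨s', fun a ha ha' => ?_⟩
    rw [hs' a (by omega) ha', ← hs ⟨a, ha⟩]
    rfl

/-- A standard tableau which starts along a given chain of squares. -/
theorem exists_tableau_of_chain {n k : ℕ} {μ : YoungDiagram} (hn : μ.card = n) (e : ℕ → ℕ × ℕ)
    (he : ∀ a b, e a ≤ e b → a ≤ b) (hl : ∀ b x, x ≤ e b → ∃ a ≤ b, x = e a)
    (hμ : ∀ a < k, e a ∈ μ) :
    ∃ s : StdTableau n μ, ∀ (a : ℕ) (_ : a < k) (ha' : a < n), (s.pos ⟨a, ha'⟩ : ℕ × ℕ) = e a := by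
  have hinj : Function.Injective e := fun a b h =>
    le_antisymm (he a b h.le) (he b a h.ge)
  let κ : YoungDiagram :=
    { cells := (Finset.range k).image e
      isLowerSet := by
        intro x y hyx hx
        simp only [Finset.coe_image, Finset.coe_range, Set.mem_image, Set.mem_Iio] at hx ⊢
        obtain ⟨b, hb, rfl⟩ := hx
        obtain ⟨a, hab, rfl⟩ := hl b y hyx
        exact ⟨a, by omega, rfl⟩ }
  let g : Fin k → {c // c ∈ κ.cells} := fun a =>
    ⟨e a, Finset.mem_image_of_mem e (Finset.mem_range.mpr a.2)⟩
  have hbij : Function.Bijective g := by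
    constructor
    · intro a b hab
      exact Fin.ext (hinj (congrArg Subtype.val hab))
    · rintro ⟨c, hc⟩
      obtain ⟨a, ha, rfl⟩ := Finset.mem_image.mp hc
      exact ⟨⟨a, Finset.mem_range.mp ha⟩, rfl⟩
  have hκ : κ ≤ μ := by
    intro c hc
    obtain ⟨a, ha, rfl⟩ := Finset.mem_image.mp hc
    exact hμ a (Finset.mem_range.mp ha)
  obtain ⟨s, hs⟩ := exists_extend_of_le hκ hn
    (⟨Equiv.ofBijective g hbij, fun a b h => Fin.le_def.mpr (he a b h)⟩ : StdTableau k κ)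
  exact ⟨s, fun a ha ha' => hs a ha ha'⟩

end Diagrams

/-! ### Path counts in Young's lattice and the bound $n!\le\sum_\mu f_\mu^2$ -/

section Counting

open Classical in
/-- The number of paths from the empty diagram to `μ` in Young's lattice. -/
def pathCount : (n : ℕ) → Diagram n → ℕ
  | 0, _ => 1
  | n + 1, μ => ∑ κ : Diagram n with κ.1 ≤ μ.1, pathCount n κ

/-- Tableaux of the diagrams one cell smaller extend to distinct tableaux of $\mu$, as the smaller
shape can be read off from the cells of the first $n$ entries. Only this inequality is needed for
the dimension count. -/
theorem pathCount_le (n : ℕ) (μ : Diagram n) : pathCount n μ ≤ Fintype.card (StdTableau n μ.1) := by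
  classical
  induction n with
  | zero =>
    rw [pathCount, Nat.succ_le_iff, Fintype.card_pos_iff]
    have hμ : μ.1.cells = ∅ := Finset.card_eq_zero.mp μ.2
    have : IsEmpty {c // c ∈ μ.1.cells} := ⟨fun c => by simpa [hμ] using c.2⟩
    exact ⟨⟨Equiv.equivOfIsEmpty _ _, fun a => a.elim0⟩⟩
  | succ n ih =>
    have hex : ∀ (κ : {κ : Diagram n // κ.1 ≤ μ.1}) (t : StdTableau n κ.1.1),
        ∃ s : StdTableau (n + 1) μ.1, ∀ a : Fin n, (s.pos a.castSucc : ℕ × ℕ) = t.pos a :=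
      fun κ t => exists_extend κ.2 (by rw [μ.2, κ.1.2]) t
    choose s hs using hex
    have hinj : Function.Injective
        (fun x : (Σ κ : {κ : Diagram n // κ.1 ≤ μ.1}, StdTableau n κ.1.1) => s x.1 x.2) := by
      rintro ⟨κ, t⟩ ⟨κ', t'⟩ h
      simp only at h
      have hp : ∀ a, (t.pos a : ℕ × ℕ) = t'.pos a := fun a => by rw [← hs, ← hs, h]
      have hsub : ∀ (κ κ' : {κ : Diagram n // κ.1 ≤ μ.1}) (t : StdTableau n κ.1.1)
          (t' : StdTableau n κ'.1.1), (∀ a, (t.pos a : ℕ × ℕ) = t'.pos a) →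
          κ.1.1.cells ⊆ κ'.1.1.cells := by
        intro κ κ' t t' hp c hc
        obtain ⟨a, ha⟩ := t.pos.surjective ⟨c, hc⟩
        have : (t.pos a : ℕ × ℕ) = c := by rw [ha]
        rw [← this, hp]
        exact (t'.pos a).2
      obtain rfl : κ = κ' := Subtype.ext (Subtype.ext (YoungDiagram.ext
        (Finset.Subset.antisymm (hsub _ _ t t' hp) (hsub _ _ t' t fun a => (hp a).symm))))
      obtain rfl : t = t' := StdTableau.ext (Equiv.ext fun a => Subtype.ext (hp a))
      rfl
    have hcard := Fintype.card_le_of_injective _ hinj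
    rw [Fintype.card_sigma] at hcard
    refine le_trans ?_ hcard
    rw [pathCount, Finset.sum_subtype (p := fun κ : Diagram n => κ.1 ≤ μ.1)
      (h := fun κ => by simp)]
    exact Finset.sum_le_sum fun κ _ => ih κ.1

/-- The row of the additional square of `μ` when `μ` has exactly one square more than `κ`. -/
def extraRow (κ μ : YoungDiagram) : ℕ := ∑ c ∈ μ.cells \ κ.cells, c.1

theorem extraRow_eq {κ μ : YoungDiagram} {c : ℕ × ℕ} (hc : c ∉ κ.cells)
    (h : insert c κ.cells = μ.cells) : extraRow κ μ = c.1 := by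
  have : μ.cells \ κ.cells = {c} := by
    rw [← h, Finset.insert_sdiff_of_notMem _ hc, Finset.sdiff_self]; rfl
  rw [extraRow, this, Finset.sum_singleton]

theorem rowLen_of_insert {κ μ : YoungDiagram} {c : ℕ × ℕ} (hc : c ∉ κ.cells)
    (h : insert c κ.cells = μ.cells) : μ.rowLen c.1 = c.2 + 1 ∧ μ.rowLen (c.1 + 1) ≤ c.2 := by
  have hcμ : (c.1, c.2) ∈ μ := by
    change c ∈ μ.cells
    rw [← h]; exact Finset.mem_insert_self _ _
  have h1 : ∀ x : ℕ × ℕ, c < x → x ∉ μ := by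
    intro x hx hxμ
    have hxμ' : x ∈ μ.cells := hxμ
    rw [← h, Finset.mem_insert] at hxμ'
    rcases hxμ' with rfl | hxκ
    · exact lt_irrefl _ hx
    · exact hc (κ.isLowerSet hx.le hxκ)
  have h2 := h1 (c.1, c.2 + 1) (by rw [Prod.lt_iff]; simp)
  have h3 := h1 (c.1 + 1, c.2) (by rw [Prod.lt_iff]; simp)
  rw [YoungDiagram.mem_iff_lt_rowLen] at hcμ h2 h3
  omega

-- A removable cell ends a row $r$ strictly longer than row $r+1$. Row $r+1$ then admits a new cell,
-- and row 0 always does, so there is at least one more addable cell than removable ones.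
open Classical in
theorem card_down_lt_card_up {n : ℕ} (μ : Diagram (n + 1)) :
    (Finset.univ.filter fun κ : Diagram n => κ.1 ≤ μ.1).card + 1 ≤
      (Finset.univ.filter fun ν : Diagram (n + 2) => μ.1 ≤ ν.1).card := by
  let R := (Finset.range (n + 1)).filter fun r => μ.1.rowLen (r + 1) < μ.1.rowLen r
  have h1 : (Finset.univ.filter fun κ : Diagram n => κ.1 ≤ μ.1).card ≤ R.card := by
    refine Finset.card_le_card_of_injOn (fun κ => extraRow κ.1 μ.1) ?_ ?_
    · intro κ hκ
      simp only [Finset.coe_filter, Finset.mem_univ, true_and, Set.mem_ofPred_eq] at hκ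
      obtain ⟨c, hc, h⟩ := exists_insert hκ (by rw [μ.2, κ.2])
      obtain ⟨h2, h3⟩ := rowLen_of_insert hc h
      have hcμ : c ∈ μ.1 := by
        change c ∈ μ.1.cells
        rw [← h]; exact Finset.mem_insert_self _ _
      have := lt_card_of_mem hcμ
      rw [μ.2] at this
      simp only [extraRow_eq hc h, R, Finset.coe_filter, Finset.mem_range, Set.mem_ofPred_eq]
      omega
    · intro κ hκ κ' hκ' heq
      simp only [Finset.coe_filter, Finset.mem_univ, true_and, Set.mem_ofPred_eq] at hκ hκ'
      obtain ⟨c, hc, h⟩ := exists_insert hκ (by rw [μ.2, κ.2])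
      obtain ⟨c', hc', h'⟩ := exists_insert hκ' (by rw [μ.2, κ'.2])
      simp only [extraRow_eq hc h, extraRow_eq hc' h'] at heq
      have e1 := (rowLen_of_insert hc h).1
      have e2 := (rowLen_of_insert hc' h').1
      obtain rfl : c = c' := Prod.ext heq (by rw [heq] at e1; omega)
      refine Subtype.ext (YoungDiagram.ext ?_)
      rw [← Finset.erase_insert hc, ← Finset.erase_insert hc', h, h']
  have h2 : (insert 0 (R.image Nat.succ)).card ≤
      (Finset.univ.filter fun ν : Diagram (n + 2) => μ.1 ≤ ν.1).card := by
    refine Finset.card_le_card_of_surjOn (fun ν => extraRow μ.1 ν.1) ?_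
    intro r hr
    have hr' : ∀ x : ℕ × ℕ, x < (r, μ.1.rowLen r) → x ∈ μ.1.cells := by
      rintro ⟨a, b⟩ hx
      change (a, b) ∈ μ.1
      rw [YoungDiagram.mem_iff_lt_rowLen]
      rw [Prod.lt_iff] at hx
      simp only at hx
      rcases eq_or_ne a r with rfl | har
      · omega
      · have har' : a + 1 ≤ r := by omega
        obtain ⟨m, rfl⟩ : ∃ m, r = m + 1 := ⟨r - 1, by omega⟩
        simp only [Finset.coe_insert, Finset.coe_image, Set.mem_insert_iff, Set.mem_image, R,
          Finset.coe_filter, Set.mem_ofPred_eq] at hr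
        rcases hr with hr | ⟨m', hm', hmm⟩
        · omega
        · obtain rfl : m' = m := by omega
          have := μ.1.rowLen_anti a m' (by omega)
          omega
    have hn : (r, μ.1.rowLen r) ∉ μ.1.cells := by
      change ¬ (r, μ.1.rowLen r) ∈ μ.1
      rw [YoungDiagram.mem_iff_lt_rowLen]; omega
    refine ⟨⟨insertCell μ.1 (r, μ.1.rowLen r) hr', ?_⟩, ?_, ?_⟩
    · have h2 : μ.1.cells.card = n + 1 := μ.2
      change (insert _ μ.1.cells).card = _
      rw [Finset.card_insert_of_notMem hn, h2]
    · simp only [Finset.coe_filter, Finset.mem_univ, true_and, Set.mem_ofPred_eq]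
      exact Finset.subset_insert _ _
    · exact extraRow_eq hn rfl
  rw [Finset.card_insert_of_notMem (by simp), Finset.card_image_of_injective _ Nat.succ_injective]
    at h2
  omega

-- A common lower neighbour can only be the intersection; when it exists, the union is a common
-- upper neighbour.
open Classical in
theorem card_common_lower_le {n : ℕ} {μ ν : Diagram (n + 1)} (h : μ ≠ ν) :
    (Finset.univ.filter fun κ : Diagram n => κ.1 ≤ μ.1 ∧ κ.1 ≤ ν.1).card ≤
      (Finset.univ.filter fun κ : Diagram (n + 2) => μ.1 ≤ κ.1 ∧ ν.1 ≤ κ.1).card := by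
  have hinf : ∀ κ : Diagram n, κ.1 ≤ μ.1 → κ.1 ≤ ν.1 → κ.1 = μ.1 ⊓ ν.1 := by
    intro κ h1 h2
    have hle : κ.1 ≤ μ.1 ⊓ ν.1 := le_inf h1 h2
    refine YoungDiagram.ext (Finset.eq_of_subset_of_card_le hle ?_)
    have hκ : κ.1.cells.card = n := κ.2
    have hμ : μ.1.cells.card = n + 1 := μ.2
    have hν : ν.1.cells.card = n + 1 := ν.2
    by_contra hlt
    have hs1 : (μ.1 ⊓ ν.1).cells ⊆ μ.1.cells := Finset.inter_subset_left
    have hs2 : (μ.1 ⊓ ν.1).cells ⊆ ν.1.cells := Finset.inter_subset_right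
    have e1 := Finset.eq_of_subset_of_card_le hs1 (by omega)
    have e2 := Finset.eq_of_subset_of_card_le hs2 (by omega)
    exact h (Subtype.ext (YoungDiagram.ext (e1.symm.trans e2)))
  rcases Finset.eq_empty_or_nonempty
    (Finset.univ.filter fun κ : Diagram n => κ.1 ≤ μ.1 ∧ κ.1 ≤ ν.1) with he | ⟨κ, hκ⟩
  · rw [he]; simp
  · have hle1 : (Finset.univ.filter fun κ : Diagram n => κ.1 ≤ μ.1 ∧ κ.1 ≤ ν.1).card ≤ 1 := by
      rw [Finset.card_le_one]
      intro a ha b hb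
      simp only [Finset.mem_filter, Finset.mem_univ, true_and] at ha hb
      exact Subtype.ext ((hinf a ha.1 ha.2).trans (hinf b hb.1 hb.2).symm)
    refine hle1.trans (Finset.card_pos.mpr ?_)
    simp only [Finset.mem_filter, Finset.mem_univ, true_and] at hκ
    have h3 := hinf κ hκ.1 hκ.2
    refine ⟨⟨μ.1 ⊔ ν.1, ?_⟩, ?_⟩
    · have h4 := Finset.card_union_add_card_inter μ.1.cells ν.1.cells
      have hκ : κ.1.cells.card = n := κ.2
      have hμ : μ.1.cells.card = n + 1 := μ.2
      have hν : ν.1.cells.card = n + 1 := ν.2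
      rw [h3] at hκ
      change (μ.1.cells ∩ ν.1.cells).card = n at hκ
      change (μ.1.cells ∪ ν.1.cells).card = n + 2
      omega
    · simp

-- This is the inequality form of $DU-UD=1$ for the up and down operators of Young's lattice.
-- Counting common upper neighbours bounds the sum below by $f_\mu$ plus the sum obtained by going
-- down and then up, and induction applies to the latter; here $f$ denotes `pathCount`.
open Classical in
theorem le_sum_up_pathCount (n : ℕ) (μ : Diagram n) :
    (n + 1) * pathCount n μ ≤ ∑ ν : Diagram (n + 1) with μ.1 ≤ ν.1, pathCount (n + 1) ν := by
  have expand : ∀ (n : ℕ) (μ : Diagram n),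
      ∑ ν : Diagram (n + 1) with μ.1 ≤ ν.1, pathCount (n + 1) ν =
      ∑ κ : Diagram n, (Finset.univ.filter fun ν : Diagram (n + 1) =>
        μ.1 ≤ ν.1 ∧ κ.1 ≤ ν.1).card * pathCount n κ := by
    intro n μ
    simp only [pathCount, Finset.sum_filter, Finset.card_filter, Finset.sum_mul]
    rw [Finset.sum_comm (s := (Finset.univ : Finset (Diagram n)))]
    refine Finset.sum_congr rfl fun ν _ => ?_
    split_ifs with h
    · refine Finset.sum_congr rfl fun κ _ => ?_
      simp [h]
    · simp [h]
  induction n with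
  | zero =>
    obtain ⟨ν, h1, h2⟩ : ∃ ν : Diagram 1, μ.1 ≤ ν.1 ∧ 1 ≤ pathCount 1 ν := by
      have hμ : μ.1.cells = ∅ := Finset.card_eq_zero.mp μ.2
      have hν : (insertCell μ.1 (0, 0) (fun x hx => absurd hx (by simp [Prod.lt_iff]))).card = 1 := by
        change (insert _ μ.1.cells).card = 1
        rw [hμ]; rfl
      refine ⟨⟨_, hν⟩, Finset.subset_insert _ _, ?_⟩
      rw [pathCount]
      refine le_trans ?_ (Finset.single_le_sum (a := μ) (fun _ _ => Nat.zero_le _) ?_)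
      · simp [pathCount]
      · simp only [Finset.mem_filter, Finset.mem_univ, true_and]
        exact Finset.subset_insert _ _
    refine le_trans ?_ (Finset.single_le_sum (a := ν) (fun _ _ => Nat.zero_le _) (by simpa using h1))
    simpa [pathCount] using h2
  | succ n ih =>
    rw [expand]
    have key : ∀ κ : Diagram (n + 1), ((if μ = κ then 1 else 0) +
        (Finset.univ.filter fun ν : Diagram n => ν.1 ≤ μ.1 ∧ ν.1 ≤ κ.1).card) *
          pathCount (n + 1) κ ≤
        (Finset.univ.filter fun ν : Diagram (n + 2) => μ.1 ≤ ν.1 ∧ κ.1 ≤ ν.1).card *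
          pathCount (n + 1) κ := by
      intro κ
      refine Nat.mul_le_mul_right _ ?_
      by_cases h : μ = κ
      · subst h
        have := card_down_lt_card_up μ
        simp only [and_self, if_true]
        omega
      · rw [if_neg h, zero_add]
        exact card_common_lower_le h
    refine le_trans ?_ (Finset.sum_le_sum fun κ _ => key κ)
    simp only [add_mul, Finset.sum_add_distrib, ite_mul, one_mul, zero_mul, Finset.sum_ite_eq,
      Finset.mem_univ, if_true]
    rw [add_comm]
    refine Nat.add_le_add_left ?_ _
    have : ∑ κ : Diagram (n + 1),
        (Finset.univ.filter fun ν : Diagram n => ν.1 ≤ μ.1 ∧ ν.1 ≤ κ.1).card *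
          pathCount (n + 1) κ =
        ∑ ν : Diagram n with ν.1 ≤ μ.1, ∑ κ : Diagram (n + 1) with ν.1 ≤ κ.1,
          pathCount (n + 1) κ := by
      simp only [Finset.sum_filter, Finset.card_filter, Finset.sum_mul]
      rw [Finset.sum_comm]
      refine Finset.sum_congr rfl fun ν _ => ?_
      split_ifs with h
      · refine Finset.sum_congr rfl fun κ _ => ?_
        simp [h]
      · simp [h]
    rw [this]
    refine le_trans (le_of_eq ?_) (Finset.sum_le_sum fun ν _ => ih ν)
    rw [← Finset.mul_sum, pathCount]
    ring

theorem factorial_le_sum_pathCount_sq (n : ℕ) :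
    n.factorial ≤ ∑ μ : Diagram n, pathCount n μ ^ 2 := by
  classical
  induction n with
  | zero =>
    refine le_trans ?_ (Finset.single_le_sum (a := (⟨⊥, rfl⟩ : Diagram 0))
      (fun _ _ => Nat.zero_le _) (Finset.mem_univ _))
    simp [pathCount]
  | succ n ih =>
    -- One factor of each square is expanded by the recursion, and the sums are exchanged so that
    -- the bound on the upward sum applies.
    have : ∑ μ : Diagram (n + 1), pathCount (n + 1) μ ^ 2 =
        ∑ κ : Diagram n, pathCount n κ *
          ∑ ν : Diagram (n + 1) with κ.1 ≤ ν.1, pathCount (n + 1) ν := by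
      simp only [Finset.mul_sum, Finset.sum_filter]
      rw [Finset.sum_comm]
      refine Finset.sum_congr rfl fun μ _ => ?_
      rw [pow_two]
      conv_lhs => enter [1]; rw [pathCount]
      rw [Finset.sum_mul, Finset.sum_filter]
      refine Finset.sum_congr rfl fun κ _ => ?_
      split_ifs <;> simp
    rw [this, Nat.factorial_succ]
    refine (Nat.mul_le_mul_left (n + 1) ih).trans ?_
    rw [Finset.mul_sum]
    refine Finset.sum_le_sum fun κ _ => ?_
    refine le_trans (le_of_eq (by ring)) (Nat.mul_le_mul_left _ (le_sum_up_pathCount n κ))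

theorem factorial_le_sum_card_sq (n : ℕ) :
    n.factorial ≤ ∑ μ : Diagram n, Fintype.card (StdTableau n μ.1) ^ 2 :=
  (factorial_le_sum_pathCount_sq n).trans
    (Finset.sum_le_sum fun μ _ => Nat.pow_le_pow_left (pathCount_le n μ) 2)

end Counting

/-! ### Matrix units and diagonal operators -/

section MatrixUnits

variable {X : Type*}

/-- The matrix units of `End(ℂ^X)`. -/
def matUnit (s t : X) : Module.End ℂ (X →₀ ℂ) := Finsupp.lsingle s ∘ₗ Finsupp.lapply t

theorem matUnit_apply (s t : X) (v : X →₀ ℂ) : matUnit s t v = Finsupp.single s (v t) := rfl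

theorem matUnit_mul_mul (a s t b : X) (S : Module.End ℂ (X →₀ ℂ)) :
    matUnit a s * S * matUnit t b = S (Finsupp.single t 1) s • matUnit a b := by
  refine LinearMap.ext fun v => ?_
  simp only [Module.End.mul_apply, LinearMap.smul_apply, matUnit_apply, Finsupp.smul_single]
  rw [← Finsupp.smul_single_one t, map_smul, Finsupp.smul_apply, smul_eq_mul, smul_eq_mul, mul_comm]

theorem matUnit_mul (a b c : X) : matUnit a b * matUnit b c = matUnit a c := by
  refine LinearMap.ext fun v => ?_
  simp [Module.End.mul_apply, matUnit_apply]

theorem eq_sum_matUnit [Fintype X] (S : Module.End ℂ (X →₀ ℂ)) :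
    S = ∑ s, ∑ t, S (Finsupp.single t 1) s • matUnit s t := by
  classical
  refine Finsupp.lhom_ext' fun u => LinearMap.ext_ring ?_
  ext r
  simp [matUnit_apply, Finsupp.single_apply, Finsupp.finsetSum_apply,
    Finset.sum_ite_eq]

/-- The diagonal operators on `ℂ^X`. -/
def diagOp (χ : X → ℂ) : Module.End ℂ (X →₀ ℂ) :=
  Finsupp.linearCombination ℂ fun t => χ t • Finsupp.single t 1

theorem diagOp_single (χ : X → ℂ) (t : X) :
    diagOp χ (Finsupp.single t 1) = χ t • Finsupp.single t 1 := by
  rw [diagOp, Finsupp.linearCombination_single, one_smul]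

theorem single_mem_of_separates [Fintype X] [DecidableEq X] (S : Subalgebra ℂ (X → ℂ))
    (h : ∀ u v, u ≠ v → ∃ χ ∈ S, χ u ≠ χ v) (u : X) : Pi.single u (1 : ℂ) ∈ S := by
  have h' : ∀ v, ∃ χ ∈ S, u ≠ v → χ u ≠ χ v := by
    intro v
    by_cases huv : u = v
    · exact ⟨1, S.one_mem, fun hne => absurd huv hne⟩
    · obtain ⟨χ, hχ, hne⟩ := h u v huv
      exact ⟨χ, hχ, fun _ => hne⟩
  choose χ hχ hne using h'
  -- Lagrange interpolation: the factor for $v$ equals 1 at $u$ and 0 at $v$.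
  have : Pi.single u (1 : ℂ) = ∏ v ∈ Finset.univ.erase u,
      (χ v u - χ v v)⁻¹ • (χ v - algebraMap ℂ (X → ℂ) (χ v v)) := by
    funext w
    rw [Finset.prod_apply]
    by_cases hw : w = u
    · subst hw
      rw [Pi.single_eq_same, Finset.prod_eq_one]
      intro v hv
      have := sub_ne_zero.mpr (hne v (Finset.ne_of_mem_erase hv).symm)
      simp [this]
    · rw [Pi.single_eq_of_ne hw, Finset.prod_eq_zero (i := w)]
      · simp [hw]
      · simp
  rw [this]
  exact S.prod_mem fun v _ => S.smul_mem (S.sub_mem (hχ v) (S.algebraMap_mem _)) _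

end MatrixUnits

/-! ### Contents separate standard tableaux -/

section Contents

variable {n : ℕ} {μ ν : YoungDiagram}

theorem sigma_ext_pos {u v : Σ μ : Diagram n, StdTableau n μ.1}
    (h : ∀ a, (u.2.pos a : ℕ × ℕ) = v.2.pos a) : u = v := by
  have hsub : ∀ (u v : Σ μ : Diagram n, StdTableau n μ.1),
      (∀ a, (u.2.pos a : ℕ × ℕ) = v.2.pos a) → u.1.1.cells ⊆ v.1.1.cells := by
    intro u v h c hc
    obtain ⟨a, ha⟩ := u.2.pos.surjective ⟨c, hc⟩
    have : (u.2.pos a : ℕ × ℕ) = c := by rw [ha]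
    rw [← this, h]
    exact (v.2.pos a).2
  have h1 := hsub u v h
  have h2 := hsub v u fun a => (h a).symm
  obtain ⟨κ, t⟩ := u
  obtain ⟨κ', t'⟩ := v
  obtain rfl : κ = κ' := Subtype.ext (YoungDiagram.ext (Finset.Subset.antisymm h1 h2))
  obtain rfl : t = t' := StdTableau.ext (Equiv.ext fun a => Subtype.ext (h a))
  rfl

theorem StdTableau.exists_entry_lt (t : StdTableau n μ) {a : Fin n} {x : ℕ × ℕ}
    (hx : x < t.pos a) : ∃ e < a, (t.pos e : ℕ × ℕ) = x := by
  obtain ⟨e, he⟩ := t.pos.surjective ⟨x, μ.isLowerSet hx.le (t.pos a).2⟩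
  have he' : (t.pos e : ℕ × ℕ) = x := by rw [he]
  refine ⟨e, lt_of_le_of_ne (t.standard e a (he' ▸ hx.le)) ?_, he'⟩
  rintro rfl
  exact hx.ne he'.symm

theorem StdTableau.pos_zero (t : StdTableau n μ) (h : 0 < n) :
    (t.pos ⟨0, h⟩ : ℕ × ℕ) = (0, 0) := by
  by_contra hne
  obtain ⟨e, he, -⟩ := t.exists_entry_lt (a := ⟨0, h⟩) (x := (0, 0))
    (lt_of_le_of_ne (Prod.le_def.mpr ⟨Nat.zero_le _, Nat.zero_le _⟩) (Ne.symm hne))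
  rw [Fin.lt_def] at he
  exact absurd he (Nat.not_lt_zero _)

/-- The entries before $j$ already fill the first row left of the column of one cell and the first
column above the row of the other. Consequently the contents of two cells addable to the same
partial diagram differ by at most $n$. -/
theorem addable_hook_le (t : StdTableau n μ) (s : StdTableau n ν) {j : Fin n}
    (h : ∀ e < j, (t.pos e : ℕ × ℕ) = s.pos e) :
    (t.pos j : ℕ × ℕ).2 + (s.pos j : ℕ × ℕ).1 ≤ n := by
  have hc := hook_le_card ((Finset.Iio j).image fun e => (t.pos e : ℕ × ℕ))
    (t.pos j : ℕ × ℕ).2 ((s.pos j : ℕ × ℕ).1 - 1) ?_ ?_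
  · have h2 := hc.trans Finset.card_image_le
    rw [Fin.card_Iio] at h2
    have := j.2
    omega
  · intro i hi
    obtain ⟨e, he, hx⟩ := t.exists_entry_lt (a := j) (x := (0, i)) (by rw [Prod.lt_iff]; simp [hi])
    exact Finset.mem_image.mpr ⟨e, by simpa using he, hx⟩
  · intro i hi
    obtain ⟨e, he, hx⟩ := s.exists_entry_lt (a := j) (x := (i + 1, 0))
      (by rw [Prod.lt_iff]; left; constructor <;> simp; omega)
    exact Finset.mem_image.mpr ⟨e, by simpa using he, by rw [h e he, hx]⟩

/-- At the first entry where the tableaux differ, the two cells are distinct and addable to the same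
partial diagram. They are therefore incomparable, so they lie on different diagonals. The shapes may
differ, so the blocks are separated as well. -/
theorem Generic.exists_content_ne {q : ℂ} (hq : Generic n q)
    {u v : Σ μ : Diagram n, StdTableau n μ.1} (h : u ≠ v) :
    ∃ j, q ^ (-u.2.content j) ≠ q ^ (-v.2.content j) := by
  have hex : (Finset.univ.filter fun a => (u.2.pos a : ℕ × ℕ) ≠ v.2.pos a).Nonempty := by
    by_contra hc
    rw [Finset.not_nonempty_iff_eq_empty, Finset.filter_eq_empty_iff] at hc
    exact h (sigma_ext_pos fun a => not_not.mp (hc (Finset.mem_univ a)))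
  obtain ⟨j, hj⟩ := Finset.exists_minimal hex
  have hne : (u.2.pos j : ℕ × ℕ) ≠ v.2.pos j := (Finset.mem_filter.mp hj.prop).2
  have hlt : ∀ e < j, (u.2.pos e : ℕ × ℕ) = v.2.pos e := by
    intro e he
    by_contra hc
    exact hj.not_lt (Finset.mem_filter.mpr ⟨Finset.mem_univ _, hc⟩) he
  have hn : 2 ≤ n := by
    by_contra hn
    have hj0 : j = ⟨0, by have := j.2; omega⟩ := Fin.ext (by have := j.2; simp only; omega)
    apply hne
    rw [hj0, StdTableau.pos_zero, StdTableau.pos_zero]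
  have b1 := addable_hook_le u.2 v.2 hlt
  have b2 := addable_hook_le v.2 u.2 fun e he => (hlt e he).symm
  have n1 : ¬ (u.2.pos j : ℕ × ℕ) < v.2.pos j := by
    intro hl
    obtain ⟨e, he, hx⟩ := v.2.exists_entry_lt hl
    rw [← hlt e he] at hx
    exact he.ne (u.2.pos.injective (Subtype.ext hx))
  have n2 : ¬ (v.2.pos j : ℕ × ℕ) < u.2.pos j := by
    intro hl
    obtain ⟨e, he, hx⟩ := u.2.exists_entry_lt hl
    rw [hlt e he] at hx
    exact he.ne (v.2.pos.injective (Subtype.ext hx))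
  have hcd : u.2.content j - v.2.content j ≠ 0 := by
    simp only [StdTableau.content]
    intro hc
    rw [Prod.lt_iff] at n1 n2
    exact hne (Prod.ext (by omega) (by omega))
  refine ⟨j, fun heq => ?_⟩
  refine zpow_ne_one_of_abs_le hn hq.pow_ne_one hcd ?_ ?_
  · simp only [StdTableau.content]
    rw [abs_le]
    constructor <;> omega
  · rw [zpow_neg, zpow_neg, inv_inj] at heq
    rw [zpow_sub₀ hq.ne_zero, heq, div_self (zpow_ne_zero _ hq.ne_zero)]

/-- Any two standard tableaux of the same shape are connected by admissible exchanges. -/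
theorem StdTableau.connected {P : StdTableau n μ → Prop}
    (hP : ∀ (i : Fin (n - 1)) (t s : StdTableau n μ), s.pos = swapFill i t.pos → P t → P s)
    {t : StdTableau n μ} (ht : P t) (s : StdTableau n μ) : P s := by
  have key : ∀ j ≤ n, ∃ t', P t' ∧ ∀ a : Fin n, n - j ≤ a → t'.pos a = s.pos a := by
    intro j
    induction j with
    | zero => exact fun _ => ⟨t, ht, fun a ha => absurd a.2 (by omega)⟩
    | succ j ih =>
      intro hj
      obtain ⟨t', h1, h2⟩ := ih (by omega)
      obtain ⟨m, hm⟩ : ∃ m : Fin n, (m : ℕ) + 1 = n - j := ⟨⟨n - j - 1, by omega⟩, by simp; omega⟩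
      -- The entry `e` in the cell that `m` has in `s` is raised to `m` by successive exchanges.
      -- Each is admissible: a different cell weakly below and to the right would hold in `s` an
      -- entry larger than `m`, where the two tableaux already agree.
      have inner : ∀ (d : ℕ) (t' : StdTableau n μ) (e : Fin n), P t' →
          (∀ a : Fin n, n - j ≤ a → t'.pos a = s.pos a) → t'.pos e = s.pos m →
          (e : ℕ) + d = m → ∃ t', P t' ∧ ∀ a : Fin n, n - (j + 1) ≤ a → t'.pos a = s.pos a := by
        intro d
        induction d with
        | zero =>
          intro t' e h1 h2 h3 h4
          obtain rfl : e = m := Fin.ext (by omega)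
          refine ⟨t', h1, fun a ha => ?_⟩
          rcases eq_or_ne a e with rfl | hne
          · exact h3
          · have : (a : ℕ) ≠ e := fun h => hne (Fin.ext h)
            exact h2 a (by omega)
        | succ d ihd =>
          intro t' e h1 h2 h3 h4
          have hm2 := m.2
          let i : Fin (n - 1) := ⟨e, by omega⟩
          have hei : entry i = e := rfl
          have hstd : IsStd (swapFill i t'.pos) := by
            rw [isStd_swapFill_iff t'.isStd, hei, h3]
            intro hle
            obtain ⟨b, hb⟩ := s.pos.surjective (t'.pos (entrySucc i))
            rw [← hb] at hle
            have hmb := s.standard m b hle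
            rw [Fin.le_def] at hmb
            rcases Nat.eq_or_lt_of_le hmb with hmb | hmb
            · rw [← Fin.ext hmb, ← h3] at hb
              have := congrArg Fin.val (t'.pos.injective hb)
              simp [i] at this
            · rw [← h2 b (by omega)] at hb
              have := congrArg Fin.val (t'.pos.injective hb)
              simp only [val_entrySucc, i] at this
              omega
          refine ihd ⟨_, hstd⟩ (entrySucc i) (hP i t' _ rfl h1) ?_ ?_ ?_
          · intro a ha
            rw [← h2 a ha]
            exact swapFill_of_ne _ _ (by simp only [i]; omega) (by simp only [i]; omega)
          · simp only [swapFill_entrySucc, hei, h3]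
          · simp only [val_entrySucc, i]; omega
      obtain ⟨e, he⟩ := t'.pos.surjective (s.pos m)
      have hem : (e : ℕ) ≤ m := by
        by_contra hlt
        have := h2 e (by omega)
        rw [he] at this
        rw [s.pos.injective this] at hlt
        exact hlt le_rfl
      exact inner (m - e) t' e h1 h2 he (by omega)
  obtain ⟨t', h1, h2⟩ := key n le_rfl
  have : t' = s := StdTableau.ext (Equiv.ext fun a => h2 a (by omega))
  exact this ▸ h1

end Contents

/-! ### The product of the seminormal representations is an isomorphism -/

section Isomorphism

variable {n : ℕ} {q : ℂ}

/-- The product of the endomorphism algebras of the representations. -/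
abbrev YoungProd (n : ℕ) : Type :=
  (μ : Diagram n) → Module.End ℂ (StdTableau n μ.1 →₀ ℂ)

/-- The homomorphism to the product of the endomorphism algebras. -/
def youngHom (h : Generic n q) : HeckeAlgebra n q →ₐ[ℂ] YoungProd n :=
  AlgHom.pi fun μ : Diagram n => youngRep h μ.1

theorem youngHom_apply (h : Generic n q) (x : HeckeAlgebra n q) (μ : Diagram n) :
    youngHom h x μ = youngRep h μ.1 x := rfl

/-- The diagonal operators in the product algebra. -/
def diagHom (n : ℕ) : ((Σ μ : Diagram n, StdTableau n μ.1) → ℂ) →ₐ[ℂ] YoungProd n :=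
  AlgHom.ofLinearMap
    { toFun := fun χ μ => diagOp fun t => χ ⟨μ, t⟩
      map_add' := fun χ ψ => by
        funext μ
        refine Finsupp.lhom_ext' fun t => LinearMap.ext_ring ?_
        simp [diagOp_single, add_smul]
      map_smul' := fun c χ => by
        funext μ
        refine Finsupp.lhom_ext' fun t => LinearMap.ext_ring ?_
        simp [diagOp_single, mul_smul] }
    (by
      funext μ
      refine Finsupp.lhom_ext' fun t => LinearMap.ext_ring ?_
      simp [diagOp_single])
    (fun χ ψ => by
      funext μ
      refine Finsupp.lhom_ext' fun t => LinearMap.ext_ring ?_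
      change diagOp _ _ = diagOp _ (diagOp _ _)
      simp only [Finsupp.lsingle_apply, diagOp_single, map_smul, smul_smul, Pi.mul_apply, mul_comm])

theorem diagHom_apply (χ : (Σ μ : Diagram n, StdTableau n μ.1) → ℂ) (μ : Diagram n) :
    diagHom n χ μ = diagOp fun t => χ ⟨μ, t⟩ := rfl

/-- The diagonal and off-diagonal coefficients in the recursion $L_{i+1}=q^{-1}g_iL_ig_i$ for the
Murphy operators, restricted to the span of $v_t$ and $v_{s_it}$. -/
theorem seminormalCoeff_murphy {d : ℤ} (hq0 : q ≠ 0) (hq1 : 1 + q ≠ 0) (hd : q ^ d ≠ 1) :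
    ((1 + q) * seminormalCoeff q d - 1) ^ 2 +
      (1 + q) ^ 2 * (seminormalCoeff q d * seminormalCoeff q (-d)) * q ^ d = q * q ^ d ∧
    ((1 + q) * seminormalCoeff q d - 1) +
      ((1 + q) * seminormalCoeff q (-d) - 1) * q ^ d = 0 := by
  have hX : q ^ d ≠ 0 := zpow_ne_zero _ hq0
  have h1 : 1 - q ^ d ≠ 0 := sub_ne_zero.mpr hd.symm
  simp only [seminormalCoeff, zpow_add₀ hq0, zpow_neg, zpow_one]
  generalize q ^ d = X at *
  have h3 : (1 - X⁻¹) = -(1 - X) / X := by field_simp; ring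
  rw [h3]
  constructor
  · field_simp
    ring
  · field_simp
    ring

theorem Generic.murphy_step (h : Generic n q) (μ : YoungDiagram) (i : Fin (n - 1)) :
    youngRep h μ (gen n q i) * diagOp (fun t : StdTableau n μ => q ^ (-t.content (entry i))) *
      youngRep h μ (gen n q i) = q • diagOp (fun t : StdTableau n μ => q ^ (-t.content (entrySucc i))) := by
  refine end_ext fun f hf => ?_
  have hD : ∀ (a : Fin n) (f : Filling n μ), diagOp (fun t : StdTableau n μ => q ^ (-t.content a))
      (tabVec f) = q ^ (-cellContent (f a)) • tabVec f := by
    intro a f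
    by_cases hf : IsStd f
    · rw [show tabVec f = Finsupp.single (⟨f, hf⟩ : StdTableau n μ) 1 from tabVec_pos ⟨f, hf⟩,
        diagOp_single]
      rfl
    · rw [tabVec_of_not hf]; simp
  obtain ⟨m1, m2⟩ := seminormalCoeff_murphy h.ne_zero h.one_add_ne (h.zpow_fillDist hf i)
  have c1 := coeff_mul_neg (q := q) hf i
  have hY : q ^ (-cellContent (f (entrySucc i))) =
      q ^ fillDist f i * q ^ (-cellContent (f (entry i))) := by
    rw [← zpow_add₀ h.ne_zero, fillDist]; congr 1; ring
  have h3 : stdInd (swapFill i f) • tabVec (swapFill i f) = tabVec (swapFill i f) := by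
    by_cases hs : IsStd (swapFill i f)
    · rw [stdInd_of hs, one_smul]
    · rw [tabVec_of_not hs, smul_zero]
  rw [youngRep_gen]
  simp only [LinearMap.sub_apply, LinearMap.smul_apply, Module.End.one_apply,
    Module.End.mul_apply, youngOp_tabVec', map_smul, map_add, map_sub, stdInd_of hf, one_smul,
    hD, swapFill_entry, fillDist_swapFill_self, swapFill_swapFill, hY]
  generalize q ^ (-cellContent (f (entry i))) = Z at *
  generalize q ^ fillDist f i = U at *
  generalize seminormalCoeff q (fillDist f i) = a at *
  generalize seminormalCoeff q (-fillDist f i) = b at *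
  generalize tabVec (swapFill i f) = w at *
  generalize stdInd (swapFill i f) = s at *
  match_scalars
  · linear_combination Z * m1 + (1 + q) ^ 2 * Z * U * c1
  · linear_combination Z * (1 + q) * a * m2

/-- Starting from the identity, since the first entry has content 0, the recursion
$L_{i+1}=q^{-1}g_iL_ig_i$ never leaves the image. -/
theorem Generic.murphy_mem (h : Generic n q) (j : ℕ) (hj : j < n) :
    diagHom n (fun u => q ^ (-u.2.content ⟨j, hj⟩)) ∈ (youngHom h).range := by
  induction j with
  | zero =>
    have : (fun u : Σ μ : Diagram n, StdTableau n μ.1 => q ^ (-u.2.content ⟨0, hj⟩)) = 1 := by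
      funext u
      simp [StdTableau.content, StdTableau.pos_zero]
    rw [this, map_one]
    exact one_mem _
  | succ j ih =>
    have hi : j < n - 1 := by omega
    have : diagHom n (fun u => q ^ (-u.2.content ⟨j + 1, hj⟩)) =
        q⁻¹ • (youngHom h (gen n q ⟨j, hi⟩) *
          diagHom n (fun u => q ^ (-u.2.content ⟨j, by omega⟩)) *
          youngHom h (gen n q ⟨j, hi⟩)) := by
      funext μ
      have := h.murphy_step μ.1 ⟨j, hi⟩
      rw [Pi.smul_apply, Pi.mul_apply, Pi.mul_apply, youngHom_apply, diagHom_apply, diagHom_apply]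
      simp only [entry, entrySucc] at this
      rw [this, smul_smul, inv_mul_cancel₀ h.ne_zero, one_smul]
    rw [this]
    have hg : youngHom h (gen n q ⟨j, hi⟩) ∈ (youngHom h).range := ⟨_, rfl⟩
    exact Subalgebra.smul_mem _ (mul_mem (mul_mem hg (ih _)) hg) _

open Classical in
/-- The matrix units of the product algebra. -/
def unitFam (μ : Diagram n) (s t : StdTableau n μ.1) : YoungProd n := Pi.single μ (matUnit s t)

theorem Generic.unitFam_self_mem (h : Generic n q) (μ : Diagram n) (t : StdTableau n μ.1) :
    unitFam μ t t ∈ (youngHom h).range := by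
  classical
  have := single_mem_of_separates ((youngHom h).range.comap (diagHom n)) (fun u v huv => by
    obtain ⟨j, hj⟩ := h.exists_content_ne huv
    exact ⟨_, h.murphy_mem j j.2, hj⟩) ⟨μ, t⟩
  rw [Subalgebra.mem_comap] at this
  convert this using 1
  funext ν
  rw [diagHom_apply, unitFam]
  refine Finsupp.lhom_ext' fun s => LinearMap.ext_ring ?_
  simp only [LinearMap.comp_apply, Finsupp.lsingle_apply, diagOp_single]
  by_cases hν : ν = μ
  · subst hν
    by_cases hs : s = t
    · subst hs; simp [matUnit_apply]
    · simp [matUnit_apply, hs]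
  · simp [hν]

/-- The matrix entry of $e_i$ from $v_t$ to $v_{s_it}$ is $a_d$, which is nonzero because $|d|\ge2$
for an admissible exchange. -/
theorem Generic.unitFam_swap_mem (h : Generic n q) (μ : Diagram n) (i : Fin (n - 1))
    (t s : StdTableau n μ.1) (hs : s.pos = swapFill i t.pos) :
    unitFam μ s t ∈ (youngHom h).range := by
  have hstd : IsStd (swapFill i t.pos) := hs ▸ s.isStd
  have ha := h.coeff_ne_zero t.isStd hstd
  have hne : t ≠ s := by
    rintro rfl
    have := DFunLike.congr_fun hs (entry i)
    rw [swapFill_entry] at this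
    exact entry_ne_entrySucc i (t.pos.injective this)
  have key : unitFam μ s s * youngHom h (idem n q i) * unitFam μ t t =
      seminormalCoeff q (fillDist t.pos i) • unitFam μ s t := by
    classical
    funext ν
    rw [Pi.mul_apply, Pi.mul_apply, Pi.smul_apply, youngHom_apply, youngRep_idem]
    by_cases hν : ν = μ
    · subst hν
      simp only [unitFam, Pi.single_eq_same]
      rw [matUnit_mul_mul, youngOp_single, ← hs, tabVec_pos]
      simp [hne]
    · simp [unitFam, hν]
  have : unitFam μ s t = (seminormalCoeff q (fillDist t.pos i))⁻¹ •
      (unitFam μ s s * youngHom h (idem n q i) * unitFam μ t t) := by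
    rw [key, smul_smul, inv_mul_cancel₀ ha, one_smul]
  rw [this]
  exact Subalgebra.smul_mem _ (mul_mem (mul_mem (h.unitFam_self_mem μ s) ⟨_, rfl⟩)
    (h.unitFam_self_mem μ t)) _

theorem unitFam_mul (μ : Diagram n) (a b c : StdTableau n μ.1) :
    unitFam μ a b * unitFam μ b c = unitFam μ a c := by
  classical
  rw [unitFam, unitFam, ← Pi.single_mul, matUnit_mul, unitFam]

theorem Generic.unitFam_mem (h : Generic n q) (μ : Diagram n) (s t : StdTableau n μ.1) :
    unitFam μ s t ∈ (youngHom h).range := by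
  refine StdTableau.connected (P := fun s => unitFam μ s t ∈ (youngHom h).range) ?_
    (h.unitFam_self_mem μ t) s
  intro i a b hab ha
  rw [← unitFam_mul μ b a t]
  exact mul_mem (h.unitFam_swap_mem μ i a b hab) ha

theorem Generic.youngHom_surjective (h : Generic n q) : Function.Surjective (youngHom h) := by
  classical
  intro y
  have hy : y = ∑ μ, ∑ s, ∑ t, y μ (Finsupp.single t 1) s • unitFam μ s t := by
    funext ν
    simp only [Finset.sum_apply, Pi.smul_apply, unitFam]
    rw [Finset.sum_eq_single ν]
    · simp only [Pi.single_eq_same]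
      exact eq_sum_matUnit (y ν)
    · intro μ _ hμ
      simp [Ne.symm hμ]
    · simp
  have : y ∈ (youngHom h).range := by
    rw [hy]
    exact sum_mem fun μ _ => sum_mem fun s _ => sum_mem fun t _ =>
      Subalgebra.smul_mem _ (h.unitFam_mem μ s t) _
  exact this

/-- The surjection goes from a space of dimension at most $n!$ onto one of dimension $\sum_\mu
f_\mu^2\ge n!$. -/
theorem Generic.youngHom_bijective (h : Generic n q) : Function.Bijective (youngHom h) := by
  obtain ⟨hfin, hle⟩ := finrank_le_factorial h.ne_zero n
  have hs := h.youngHom_surjective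
  have h1 : Module.finrank ℂ (YoungProd n) = ∑ μ : Diagram n, Fintype.card (StdTableau n μ.1) ^ 2 := by
    rw [Module.finrank_pi_fintype]
    refine Finset.sum_congr rfl fun μ _ => ?_
    rw [Module.finrank_linearMap, Module.finrank_finsupp_self, pow_two]
  have h2 := factorial_le_sum_card_sq n
  have h3 := LinearMap.finrank_le_finrank_of_surjective (f := (youngHom h).toLinearMap) hs
  have h4 : Module.finrank ℂ (HeckeAlgebra n q) = Module.finrank ℂ (YoungProd n) := by omega
  have h5 : Function.Injective (youngHom h).toLinearMap := by
    have := LinearMap.injective_iff_surjective_of_finrank_eq_finrank (K := ℂ)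
      (V := HeckeAlgebra n q) (V₂ := YoungProd n) h4 (f := (youngHom h).toLinearMap)
    exact this.mpr hs
  exact ⟨h5, hs⟩

end Isomorphism

/-! ### Eigenvectors of the generators in the seminormal representations -/

section Eigenvectors

variable {n : ℕ} {μ : YoungDiagram} {q : ℂ}

open Classical in
theorem tabVec_apply (f : Filling n μ) (t : StdTableau n μ) :
    tabVec f t = if t.pos = f then 1 else 0 := by
  by_cases hf : IsStd f
  · rw [show tabVec f = Finsupp.single (⟨f, hf⟩ : StdTableau n μ) 1 from tabVec_pos ⟨f, hf⟩,
      Finsupp.single_apply]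
    congr 1
    rw [eq_iff_iff, StdTableau.ext_iff, eq_comm]
  · rw [tabVec_of_not hf, if_neg]
    · rfl
    · rintro rfl
      exact hf t.isStd

open Classical in
theorem youngOp_apply (i : Fin (n - 1)) (v : StdTableau n μ →₀ ℂ) (t : StdTableau n μ) :
    youngOp n q μ i v t = seminormalCoeff q (fillDist t.pos i) * v t +
      if h : IsStd (swapFill i t.pos) then
        seminormalCoeff q (-fillDist t.pos i) * v ⟨swapFill i t.pos, h⟩ else 0 := by
  induction v using Finsupp.induction_linear with
  | zero => simp
  | add v w hv hw =>
    rw [map_add, Finsupp.add_apply, hv, hw, Finsupp.add_apply]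
    split_ifs with h
    · rw [Finsupp.add_apply]; ring
    · ring
  | single s c =>
    rw [← Finsupp.smul_single_one, map_smul, youngOp_single]
    simp only [Finsupp.smul_apply, Finsupp.add_apply, smul_eq_mul, tabVec_apply,
      Finsupp.single_apply]
    have hst : t.pos = swapFill i s.pos ↔ s.pos = swapFill i t.pos := by
      constructor <;> intro h <;> rw [h, swapFill_swapFill]
    by_cases h1 : t.pos = swapFill i s.pos
    · have h2 := hst.mp h1
      have hstd : IsStd (swapFill i t.pos) := h2 ▸ s.isStd
      have h3 : s = ⟨swapFill i t.pos, hstd⟩ := StdTableau.ext h2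
      have h4 : s ≠ t := by
        rintro rfl
        have := DFunLike.congr_fun h2 (entry i)
        rw [swapFill_entry] at this
        exact entry_ne_entrySucc i (s.pos.injective this)
      have h5 : fillDist s.pos i = - fillDist t.pos i := by rw [h2, fillDist_swapFill_self]
      rw [if_neg h4, if_pos h1, dif_pos hstd, if_pos h3, h5]
      ring
    · have h6 : (if h : IsStd (swapFill i t.pos) then seminormalCoeff q (-fillDist t.pos i) *
          (c * if s = ⟨swapFill i t.pos, h⟩ then (1 : ℂ) else 0) else 0) = 0 := by
        split_ifs with h h'
        · exact absurd (hst.mpr (congrArg StdTableau.pos h')) h1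
        · ring
        · rfl
      rw [h6, if_neg h1]
      by_cases h4 : s = t
      · subst h4; simp; ring
      · simp [h4]

theorem Generic.coeff_neg_ne_zero (h : Generic n q) {f : Filling n μ} (hf : IsStd f)
    {i : Fin (n - 1)} (hs : IsStd (swapFill i f)) :
    seminormalCoeff q (-fillDist f i) ≠ 0 := by
  have := h.coeff_ne_zero hs (i := i) (by rwa [swapFill_swapFill])
  rwa [fillDist_swapFill_self] at this

/-- Comparing coordinates at $t$ and using $1-a_d=a_{-d}$ gives $a_{-d}v_t=a_{-d}v_{s_it}$ with
$a_{-d}\neq0$. When $d=-1$ the image of $e_i$ has zero coordinate at $t$. -/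
theorem Generic.support_fixed (h : Generic n q) {i : Fin (n - 1)} {v : StdTableau n μ →₀ ℂ}
    (hv : youngOp n q μ i v = v) {t : StdTableau n μ} (ht : v t ≠ 0) :
    fillDist t.pos i ≠ -1 ∧ ∀ s : StdTableau n μ, s.pos = swapFill i t.pos → v s ≠ 0 := by
  classical
  have key := youngOp_apply (q := q) i v t
  rw [hv] at key
  constructor
  · intro hd
    have hs : ¬ IsStd (swapFill i t.pos) := by
      intro hs
      have := t.isStd.two_le_abs hs
      omega
    rw [dif_neg hs, hd, seminormalCoeff_neg_one] at key
    simp [ht] at key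
  · intro s hst hvs
    have hs : IsStd (swapFill i t.pos) := hst ▸ s.isStd
    have hs' : (⟨swapFill i t.pos, hs⟩ : StdTableau n μ) = s := StdTableau.ext hst.symm
    rw [dif_pos hs, hs', hvs, mul_zero, add_zero] at key
    have h1 := seminormalCoeff_add_neg h.ne_zero h.one_add_ne (h.zpow_fillDist t.isStd i)
    have h2 := mul_ne_zero (h.coeff_neg_ne_zero t.isStd hs) ht
    exact h2 (by linear_combination v t * h1 + key)

/-- The coordinate at $t$ reads $a_dv_t+a_{-d}v_{s_it}=0$ with $a_d\neq0$; for $d=1$ it reads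
$v_t=0$. -/
theorem Generic.support_killed (h : Generic n q) {i : Fin (n - 1)} {v : StdTableau n μ →₀ ℂ}
    (hv : youngOp n q μ i v = 0) {t : StdTableau n μ} (ht : v t ≠ 0) :
    fillDist t.pos i ≠ 1 ∧ ∀ s : StdTableau n μ, s.pos = swapFill i t.pos → v s ≠ 0 := by
  classical
  have key := youngOp_apply (q := q) i v t
  rw [hv, Finsupp.zero_apply] at key
  constructor
  · intro hd
    have hs : ¬ IsStd (swapFill i t.pos) := by
      intro hs
      have := t.isStd.two_le_abs hs
      omega
    rw [dif_neg hs, hd, seminormalCoeff_one h.one_add_ne (h.ne_one i),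
      one_mul, add_zero] at key
    exact ht key.symm
  · intro s hst hvs
    have hs : IsStd (swapFill i t.pos) := hst ▸ s.isStd
    have hs' : (⟨swapFill i t.pos, hs⟩ : StdTableau n μ) = s := StdTableau.ext hst.symm
    rw [dif_pos hs, hs', hvs, mul_zero, add_zero] at key
    exact mul_ne_zero (h.coeff_ne_zero t.isStd hs) ht key.symm

/-- A set of standard tableaux closed under admissible exchanges of the first `k` entries, one of
which fills the square `x` next to the corner, contains a tableau with the entry `1` in `x`. -/
theorem StdTableau.exists_entry_one_eq {k : ℕ} {P : StdTableau n μ → Prop}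
    (hP : ∀ (i : Fin (n - 1)) (t s : StdTableau n μ), (i : ℕ) + 1 < k →
      s.pos = swapFill i t.pos → P t → P s)
    {x : ℕ × ℕ} (hx0 : x ≠ (0, 0)) (hx : ∀ y, y < x → y = (0, 0)) (e : ℕ) (he : e < n)
    (hek : e < k) (t : StdTableau n μ) (ht : P t) (hte : (t.pos ⟨e, he⟩ : ℕ × ℕ) = x) :
    ∃ (h : 1 < n) (s : StdTableau n μ), P s ∧ (s.pos ⟨1, h⟩ : ℕ × ℕ) = x ∧ 1 < k := by
  induction e generalizing t with
  | zero => exact absurd (hte.symm.trans (t.pos_zero he)) hx0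
  | succ e ih =>
    rcases Nat.eq_zero_or_pos e with rfl | hpos
    · exact ⟨he, t, ht, hte, hek⟩
    · let i : Fin (n - 1) := ⟨e, by omega⟩
      have hstd : IsStd (swapFill i t.pos) := by
        rw [isStd_swapFill_iff t.isStd]
        intro hle
        change (t.pos (entry i) : ℕ × ℕ) ≤ t.pos ⟨e + 1, he⟩ at hle
        rw [hte] at hle
        have hne : (t.pos (entry i) : ℕ × ℕ) ≠ x := by
          intro h
          rw [← hte] at h
          have := congrArg Fin.val (t.pos.injective (Subtype.ext h))
          simp [i] at this
        have h0 := hx _ (lt_of_le_of_ne hle hne)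
        rw [← t.pos_zero (by omega)] at h0
        have := congrArg Fin.val (t.pos.injective (Subtype.ext h0))
        simp only [val_entry, i] at this
        omega
      refine ih (by omega) (by omega) ⟨_, hstd⟩ (hP i t _ hek rfl ht) ?_
      change (swapFill i t.pos (entry i) : ℕ × ℕ) = x
      rw [swapFill_entry]
      exact hte

/-- Pigeonhole: the cells not above `x` in the order are too few for the first `k` entries. One of
these entries then lies at or beyond `x`, and `x` itself holds an entry that is no larger. The cases
used are the first column and the first row. -/
theorem StdTableau.exists_entry_eq {k N : ℕ} (hkn : k ≤ n) (hN : N < k) (x : ℕ × ℕ)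
    (proj : ℕ × ℕ → ℕ) (h1 : ∀ c ∈ μ, ¬ x ≤ c → proj c < N)
    (h2 : ∀ c c', ¬ x ≤ c → ¬ x ≤ c' → proj c = proj c' → c = c') (t : StdTableau n μ) :
    ∃ (e : ℕ) (he : e < n), e < k ∧ (t.pos ⟨e, he⟩ : ℕ × ℕ) = x := by
  by_contra! hc
  have h3 : ∀ a : Fin k, ¬ x ≤ t.pos ⟨a, by omega⟩ := by
    intro a hle
    rcases eq_or_lt_of_le hle with h | h
    · exact hc a (by omega) a.2 h.symm
    · obtain ⟨e, he, hx⟩ := t.exists_entry_lt h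
      rw [Fin.lt_def] at he
      exact hc e e.2 (lt_trans he a.2) hx
  have hinj : Function.Injective
      (fun a : Fin k => (⟨proj (t.pos ⟨a, by omega⟩), h1 _ (t.pos _).2 (h3 a)⟩ : Fin N)) := by
    intro a b hab
    have := t.pos.injective (Subtype.ext (h2 _ _ (h3 a) (h3 b) (congrArg Fin.val hab)))
    exact Fin.ext (Fin.mk.inj_iff.mp this)
  have := Fintype.card_le_of_injective _ hinj
  simp at this
  omega

theorem fillDist_of_pos (t : StdTableau n μ) (i : Fin (n - 1)) :
    fillDist t.pos i = cellContent (t.pos ⟨i, by omega⟩) - cellContent (t.pos ⟨i + 1, by omega⟩) :=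
  rfl

theorem Generic.exists_fixed_iff (h : Generic n q) {k : ℕ} (hkn : k ≤ n) (hμ : μ.card = n) :
    (∃ v : StdTableau n μ →₀ ℂ, v ≠ 0 ∧ ∀ i : Fin (n - 1), (i : ℕ) + 1 < k →
      youngOp n q μ i v = v) ↔ k ≤ numRows μ := by
  constructor
  · rintro ⟨v, hv0, hv⟩
    by_contra! hk
    obtain ⟨t, ht⟩ := Finsupp.ne_iff.mp hv0
    rw [Finsupp.zero_apply] at ht
    obtain ⟨e, he, hek, hx⟩ := t.exists_entry_eq hkn hk (0, 1) Prod.fst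
      (by
        rintro ⟨r, c⟩ hc hle
        rw [Prod.le_def] at hle
        obtain rfl : c = 0 := by simp at hle; omega
        exact YoungDiagram.mem_iff_lt_colLen.mp hc)
      (by
        rintro ⟨r, c⟩ ⟨r', c'⟩ hle hle' hr
        rw [Prod.le_def] at hle hle'
        simp at hle hle' hr
        ext <;> simp <;> omega)
    obtain ⟨h1, s, hs, hsx, hk1⟩ := StdTableau.exists_entry_one_eq (k := k) (P := fun t => v t ≠ 0)
      (fun i t s hi hst ht => (h.support_fixed (hv i hi) ht).2 s hst) (x := (0, 1)) (by simp)
      (by rintro ⟨r, c⟩ hy; rw [Prod.lt_iff] at hy; simp at hy; ext <;> simp <;> omega)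
      e he hek t ht hx
    -- The first entry is in the corner and the second to its right, so the axial distance is $-1$.
    refine (h.support_fixed (hv ⟨0, by omega⟩ (by simpa using hk1)) hs).1 ?_
    rw [fillDist_of_pos]
    simp only [zero_add, hsx, s.pos_zero, cellContent]
    simp
  · intro hk
    obtain ⟨t, ht⟩ := exists_tableau_of_chain hμ (k := k) (fun a => (a, 0))
      (by intro a b hab; simpa using hab)
      (by rintro b ⟨r, c⟩ hx; rw [Prod.le_def] at hx; exact ⟨r, hx.1, by ext <;> simp_all⟩)
      (by intro a ha; rw [YoungDiagram.mem_iff_lt_colLen]; exact lt_of_lt_of_le ha hk)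
    refine ⟨Finsupp.single t 1, by simp, fun i hi => ?_⟩
    have h1 := ht i (by omega) (by omega)
    have h2 := ht (i + 1) hi (by omega)
    have hd : fillDist t.pos i = 1 := by
      rw [fillDist_of_pos, h1, h2]
      simp [cellContent]
    have hs : ¬ IsStd (swapFill i t.pos) := by
      intro hs
      have := t.isStd.two_le_abs hs
      omega
    rw [youngOp_single, hd, tabVec_of_not hs, add_zero,
      seminormalCoeff_one h.one_add_ne (h.ne_one i), one_smul]

theorem Generic.exists_killed_iff (h : Generic n q) {k : ℕ} (hkn : k ≤ n) (hμ : μ.card = n) :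
    (∃ v : StdTableau n μ →₀ ℂ, v ≠ 0 ∧ ∀ i : Fin (n - 1), (i : ℕ) + 1 < k →
      youngOp n q μ i v = 0) ↔ k ≤ numCols μ := by
  constructor
  · rintro ⟨v, hv0, hv⟩
    by_contra! hk
    obtain ⟨t, ht⟩ := Finsupp.ne_iff.mp hv0
    rw [Finsupp.zero_apply] at ht
    obtain ⟨e, he, hek, hx⟩ := t.exists_entry_eq hkn hk (1, 0) Prod.snd
      (by
        rintro ⟨r, c⟩ hc hle
        rw [Prod.le_def] at hle
        obtain rfl : r = 0 := by simp at hle; omega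
        exact YoungDiagram.mem_iff_lt_rowLen.mp hc)
      (by
        rintro ⟨r, c⟩ ⟨r', c'⟩ hle hle' hr
        rw [Prod.le_def] at hle hle'
        simp at hle hle' hr
        ext <;> simp <;> omega)
    obtain ⟨h1, s, hs, hsx, hk1⟩ := StdTableau.exists_entry_one_eq (k := k) (P := fun t => v t ≠ 0)
      (fun i t s hi hst ht => (h.support_killed (hv i hi) ht).2 s hst) (x := (1, 0)) (by simp)
      (by rintro ⟨r, c⟩ hy; rw [Prod.lt_iff] at hy; simp at hy; ext <;> simp <;> omega)
      e he hek t ht hx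
    refine (h.support_killed (hv ⟨0, by omega⟩ (by simpa using hk1)) hs).1 ?_
    rw [fillDist_of_pos]
    simp only [zero_add, hsx, s.pos_zero, cellContent]
    simp
  · intro hk
    obtain ⟨t, ht⟩ := exists_tableau_of_chain hμ (k := k) (fun a => (0, a))
      (by intro a b hab; simpa using hab)
      (by rintro b ⟨r, c⟩ hx; rw [Prod.le_def] at hx; exact ⟨c, hx.2, by ext <;> simp_all⟩)
      (by intro a ha; rw [YoungDiagram.mem_iff_lt_rowLen]; exact lt_of_lt_of_le ha hk)
    refine ⟨Finsupp.single t 1, by simp, fun i hi => ?_⟩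
    have h1 := ht i (by omega) (by omega)
    have h2 := ht (i + 1) hi (by omega)
    have hd : fillDist t.pos i = -1 := by
      rw [fillDist_of_pos, h1, h2]
      simp [cellContent]
    rw [youngOp_single, hd, seminormalCoeff_neg_one, zero_smul]

end Eigenvectors

/-! ### The ideals generated by the symmetrizers and antisymmetrizers -/

section Ideals

variable {n : ℕ} {q : ℂ}

theorem qFactorial_ne_zero {k : ℕ} (hq : ∀ p : ℕ, 2 ≤ p → p ≤ k → q ^ p ≠ 1) :
    qFactorial q k ≠ 0 := by
  rw [qFactorial, Finset.prod_ne_zero_iff]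
  intro m hm
  rw [Finset.mem_range] at hm
  rcases Nat.eq_zero_or_pos m with rfl | hpos
  · simp
  · intro h0
    have := geom_sum_mul q (m + 1)
    rw [h0, zero_mul] at this
    exact hq (m + 1) (by omega) (by omega) (sub_eq_zero.mp this.symm)

/-- An element all of whose left multiples by generators are multiples by `e` acts by a
nonzero operator iff there is a common eigenvector. -/
theorem map_ne_zero_iff_exists {k : ℕ} {V : Type*} [AddCommGroup V] [Module ℂ V]
    (ρ : HeckeAlgebra k q →ₐ[ℂ] Module.End ℂ V) {x : HeckeAlgebra k q} {c e : ℂ} (hc : c ≠ 0)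
    (hx : ∀ i, gen k q i * x = e • x)
    (hv : ∀ v, (∀ i, ρ (gen k q i) v = e • v) → ρ x v = c • v) :
    ρ x ≠ 0 ↔ ∃ v, v ≠ 0 ∧ ∀ i, ρ (gen k q i) v = e • v := by
  constructor
  · intro h
    obtain ⟨w, hw⟩ := DFunLike.ne_iff.mp h
    refine ⟨ρ x w, hw, fun i => ?_⟩
    rw [← Module.End.mul_apply, ← map_mul, hx, map_smul, LinearMap.smul_apply]
  · rintro ⟨v, hv0, hv1⟩ h
    have := hv v hv1
    rw [h, LinearMap.zero_apply] at this
    exact smul_ne_zero hc hv0 this.symm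

theorem forall_shiftIdx {k : ℕ} (hkn : k ≤ n) {P : Fin (n - 1) → Prop} :
    (∀ i : Fin (k - 1), P (shiftIdx (c := 0) hkn i)) ↔ ∀ i : Fin (n - 1), (i : ℕ) + 1 < k → P i := by
  constructor
  · intro h i hi
    exact h ⟨i, by omega⟩
  · intro h i
    exact h _ (by have := i.2; simp only [shiftIdx]; omega)

theorem Generic.youngRep_E_ne_zero_iff (h : Generic n q) {k : ℕ} (hkn : k ≤ n) (μ : Diagram n) :
    youngRep h μ.1 (E q hkn) ≠ 0 ↔ k ≤ numRows μ.1 := by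
  have hk : qFactorial q k ≠ 0 :=
    qFactorial_ne_zero fun p hp hpk => h.pow_ne_one p hp (hpk.trans hkn)
  have h1 := map_ne_zero_iff_exists ((youngRep h μ.1).comp (incl q hkn)) hk (gen_mul_posA k)
    (fun v hv => map_posA_apply k _ hv)
  rw [← h.exists_fixed_iff hkn μ.2, E, map_smul, map_smul, smul_ne_zero_iff_right (inv_ne_zero hk)]
  refine h1.trans (exists_congr fun v => and_congr_right fun _ => ?_)
  rw [← forall_shiftIdx hkn]
  refine forall_congr' fun i => ?_
  rw [AlgHom.comp_apply, shift_gen, youngRep_gen, LinearMap.sub_apply, LinearMap.smul_apply,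
    Module.End.one_apply, sub_eq_iff_eq_add]
  -- With $g_i=(1+q)e_i-1$, the equation $g_iv=qv$ becomes $(1+q)e_iv=(1+q)v$.
  nth_rewrite 3 [← one_smul ℂ v]
  rw [← add_smul, add_comm q 1]
  exact smul_right_inj h.one_add_ne

theorem Generic.youngRep_Eneg_ne_zero_iff (h : Generic n q) {k : ℕ} (hkn : k ≤ n) (μ : Diagram n) :
    youngRep h μ.1 (Eneg q hkn) ≠ 0 ↔ k ≤ numCols μ.1 := by
  have hk : qFactorial q⁻¹ k ≠ 0 := qFactorial_ne_zero fun p hp hpk => by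
    rw [inv_pow, ne_eq, inv_eq_one]
    exact h.pow_ne_one p hp (hpk.trans hkn)
  have h1 := map_ne_zero_iff_exists ((youngRep h μ.1).comp (incl q hkn)) hk
    (gen_mul_negA h.ne_zero k) (fun v hv => map_negA_apply k _ hv)
  rw [← h.exists_killed_iff hkn μ.2, Eneg, map_smul, map_smul,
    smul_ne_zero_iff_right (inv_ne_zero hk)]
  refine h1.trans (exists_congr fun v => and_congr_right fun _ => ?_)
  rw [← forall_shiftIdx hkn]
  refine forall_congr' fun i => ?_
  rw [AlgHom.comp_apply, shift_gen, youngRep_gen, LinearMap.sub_apply, LinearMap.smul_apply,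
    Module.End.one_apply, neg_smul, one_smul, sub_eq_neg_self, smul_eq_zero_iff_right h.one_add_ne]

theorem sum_matUnit_self {X : Type*} [Fintype X] : ∑ a : X, matUnit a a = 1 := by
  classical
  refine Finsupp.lhom_ext' fun u => LinearMap.ext_ring ?_
  ext r
  simp [matUnit_apply, Finsupp.single_apply, Finsupp.finsetSum_apply]

theorem Generic.isYoungFamily (h : Generic n q) :
    IsYoungFamily n q fun μ : Diagram n => youngRep h μ.1 where
  map_idem μ i := youngRep_idem h μ.1 i
  bijective := h.youngHom_bijective

/-- The central supports are the preimages of the block identities. A nonzero component generates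
its whole block, since a full matrix algebra is simple. -/
theorem Generic.correspondsTo_span (h : Generic n q) {x : HeckeAlgebra n q} {S : Set (Diagram n)}
    (hS : ∀ μ : Diagram n, youngRep h μ.1 x ≠ 0 ↔ μ ∈ S) :
    CorrespondsTo (fun μ : Diagram n => youngRep h μ.1) (TwoSidedIdeal.span {x}) S := by
  classical
  have hinj := h.youngHom_bijective.1
  choose p hp using fun μ : Diagram n =>
    h.youngHom_surjective (Pi.single μ (1 : Module.End ℂ (StdTableau n μ.1 →₀ ℂ)))
  have hpx : ∀ μ y, youngHom h (p μ * y) = Pi.single μ (youngRep h μ.1 y) := by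
    intro μ y
    rw [map_mul, hp, ← Pi.single_mul_left, one_mul]; rfl
  have hxp : ∀ μ y, youngHom h (y * p μ) = Pi.single μ (youngRep h μ.1 y) := by
    intro μ y
    rw [map_mul, hp, ← Pi.single_mul_right, mul_one]; rfl
  refine ⟨p, fun μ => ⟨hinj ?_, fun y => hinj ?_, fun y => ?_⟩, le_antisymm ?_ ?_⟩
  · rw [map_mul, hp, ← Pi.single_mul, one_mul]
  · rw [hpx, hxp]
  · rw [← map_eq_zero_iff (youngHom h) hinj, hpx, Pi.single_eq_zero_iff]
  · rw [TwoSidedIdeal.span_le, Set.singleton_subset_iff]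
    have hx : x = ∑ μ, p μ * x := by
      apply hinj
      rw [map_sum]
      simp only [hpx]
      rw [Finset.univ_sum_single (fun μ : Diagram n => youngRep h μ.1 x)]
      rfl
    rw [hx]
    refine sum_mem fun μ _ => ?_
    by_cases hμ : μ ∈ S
    · exact TwoSidedIdeal.mul_mem_right _ _ _ (TwoSidedIdeal.subset_span ⟨μ, hμ, rfl⟩)
    · have : p μ * x = 0 := by
        apply hinj
        rw [hpx, not_not.mp (mt (hS μ).mp hμ), Pi.single_zero, map_zero]
      rw [this]
      exact zero_mem _
  · rw [TwoSidedIdeal.span_le]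
    rintro _ ⟨μ, hμ, rfl⟩
    have hne := (hS μ).mpr hμ
    obtain ⟨s, t, hst⟩ : ∃ s t, youngRep h μ.1 x (Finsupp.single t 1) s ≠ 0 := by
      by_contra! hc
      apply hne
      rw [eq_sum_matUnit (youngRep h μ.1 x)]
      simp [hc]
    choose l hl using fun a : StdTableau n μ.1 => h.youngHom_surjective (unitFam μ a s)
    choose r hr using fun a : StdTableau n μ.1 => h.youngHom_surjective (unitFam μ t a)
    -- With a nonzero entry $x_{st}$, the identity $E_{as}xE_{ta}=x_{st}E_{aa}$, summed over $a$,
    -- recovers the identity of the block.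
    have key : p μ = ∑ a, algebraMap ℂ (HeckeAlgebra n q)
        (youngRep h μ.1 x (Finsupp.single t 1) s)⁻¹ * (l a * x * r a) := by
      apply hinj
      rw [map_sum, hp]
      have hterm : ∀ a, youngHom h (algebraMap ℂ (HeckeAlgebra n q)
          (youngRep h μ.1 x (Finsupp.single t 1) s)⁻¹ * (l a * x * r a)) =
          Pi.single μ (matUnit a a) := by
        intro a
        rw [← Algebra.smul_def, map_smul, map_mul, map_mul, hl, hr, unitFam, unitFam,
          ← Pi.single_mul_left, ← Pi.single_mul, youngHom_apply, matUnit_mul_mul,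
          ← Pi.single_smul, smul_smul, inv_mul_cancel₀ hst, one_smul]
      simp only [hterm]
      funext ν
      by_cases hν : ν = μ
      · subst hν
        simp only [Finset.sum_apply, Pi.single_eq_same]
        exact (sum_matUnit_self).symm
      · simp [hν]
    rw [key]
    refine sum_mem fun a _ => TwoSidedIdeal.mul_mem_left _ _ _ (TwoSidedIdeal.mul_mem_right _ _ _
      (TwoSidedIdeal.mul_mem_left _ _ _ (TwoSidedIdeal.subset_span rfl)))

end Ideals

end Hecke

end

theorem proposition2p4 (n k : ℕ) (hk : 1 ≤ k) (hkn : k ≤ n) (q : ℂ) (hq0 : q ≠ 0) (hq1 : q ≠ -1)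
    (hq : ∀ p : ℕ, 2 ≤ p → p ≤ n → q ^ p ≠ 1) :
    ∃ π : (μ : Hecke.Diagram n) →
        Hecke.HeckeAlgebra n q →ₐ[ℂ] Module.End ℂ (Hecke.StdTableau n μ.1 →₀ ℂ),
      Hecke.IsYoungFamily n q π ∧
      Hecke.CorrespondsTo π (TwoSidedIdeal.span {Hecke.E q hkn})
        {μ : Hecke.Diagram n | k ≤ Hecke.numRows μ.1} ∧
      Hecke.CorrespondsTo π (TwoSidedIdeal.span {Hecke.Eneg q hkn})
        {μ : Hecke.Diagram n | k ≤ Hecke.numCols μ.1} := by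
  have h : Hecke.Generic n q := ⟨hq0, hq1, hq⟩
  exact ⟨_, h.isYoungFamily, h.correspondsTo_span (h.youngRep_E_ne_zero_iff hkn),
    h.correspondsTo_span (h.youngRep_Eneg_ne_zero_iff hkn)⟩
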